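/- **Model ($\mathrm{KT}_1$ LOCAL).** A network is a finite connected undirected graph $G=(V,E)$ with $n=|V|$ nodes and diameter $D$; the nodes carry distinct identifiers (arbitrary natural numbers). Initially a node knows its own identifier, the identifiers of its neighbours, and an estimate of $n$. All nodes run the same program in synchronous rounds. In each round a running node tosses finitely many private independent fair coins, performs arbitrary local computation on its state, its coin tosses and the messages it has just received (each labelled by the identifier of its sender), and sends at most one message, of unrestricted size, to each of its neighbours, possibly different messages to different neighbours. A node may halt with an output; after that it does nothing. An execution elects a leader within $R$ rounds if after some $T\le R$ rounds all nodes have halted and there is a node $\ell$ such that every node outputs the identifier of $\ell$. The number of messages of an execution is the total number of messages sent over all rounds by all nodes. **Statement.** Let $a\ge 1$ be a real constant and $c\ge 0$ an integer constant. There are a randomized algorithm in the $\mathrm{KT}_1$ LOCAL model and a constant $C$, both depending only on $a$ and $c$, such that for every network in which the estimate $N_v$ of every node $v$ is a natural number satisfying $n/a\le N_v\le a\,n$, with probability at least $1-n^{-c}$ the algorithm elects a leader within $C\,(D\log n+\log^3 n)$ rounds and sends at most $C\, n\log^4 n$ messages. -/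

import Mathlib

open MeasureTheory

universe u

/-- What a node knows before the first round in the `KT1` model: its own identifier, the
identifiers of its neighbours, and its estimate of the number of nodes. -/
structure LocalInput where
  id : ℕ
  nbrIds : Finset ℕ
  estimate : ℕ

/-- A randomized distributed algorithm for the synchronous `KT1` LOCAL model: one program,
executed by every node of every network. Messages are elements of an arbitrary type (no size
restriction), local computation is arbitrary, and in each round a node may toss finitely many
private fair coins. Messages are addressed, and received messages are labelled, by identifiers
of neighbours. -/
structure KT1LocalAlgorithm where
  /-- local states -/
  State : Type
  /-- messages -/
  Msg : Type
  /-- the initial state -/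
  init : LocalInput → State
  /-- `output s = some x` means that a node in state `s` has halted with output `x`;
  `output s = none` means that it is still running -/
  output : State → Option ℕ
  /-- the number of coins that a node in a given state tosses in the coming round -/
  coins : State → ℕ
  /-- one round: from the current state, the outcomes of the coin tosses and the received messages
  (by identifier of the sender) to the new state and the messages to be sent (by identifier of
  the addressee) -/
  step : State → List Bool → (ℕ → Option Msg) → State × (ℕ → Option Msg)

/-- A communication network: a graph on the set `V` of nodes, with an identifier and an estimate of
the number of nodes at each node. -/
structure Network (V : Type u) where
  graph : SimpleGraph V
  id : V → ℕ
  estimate : V → ℕ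

/-- The outcomes of all coins: `ω (v, t, i)` is the `i`-th coin available to node `v` in
round `t`. -/
abbrev CoinTosses (V : Type u) : Type u := V × ℕ × ℕ → Bool

/-- All coins are fair and independent. -/
noncomputable def coinMeasure (V : Type u) : Measure (CoinTosses V) :=
  Measure.infinitePi fun _ => (PMF.uniformOfFintype Bool).toMeasure

namespace KT1LocalAlgorithm

/-- A global configuration between two rounds: the state of every node, and for each ordered pair
`(u, v)` the message (if any) that `u` sent to `v` in the previous round. -/
structure Config (A : KT1LocalAlgorithm) (V : Type u) where
  state : V → A.State
  transit : V → V → Option A.Msg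

variable {V : Type u}

open Classical in
/-- The initial knowledge of node `v`. -/
noncomputable def localInput [Fintype V] (N : Network V) (v : V) : LocalInput where
  id := N.id v
  nbrIds := (Finset.univ.filter fun w => N.graph.Adj v w).image N.id
  estimate := N.estimate v

open Classical in
/-- The messages that reach `v`, labelled by the identifiers of their senders. (Identifiers are
unique in the networks considered, so the sender is determined by its label.) -/
noncomputable def inbox (A : KT1LocalAlgorithm) (N : Network V) (c : A.Config V) (v : V) :
    ℕ → Option A.Msg :=
  fun i => if h : ∃ u, N.graph.Adj u v ∧ N.id u = i then c.transit h.choose v else none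

/-- The action of node `v` in round `t`. A halted node keeps its state and sends nothing. -/
noncomputable def nodeStep (A : KT1LocalAlgorithm) (N : Network V) (ω : CoinTosses V) (t : ℕ)
    (c : A.Config V) (v : V) : A.State × (ℕ → Option A.Msg) :=
  if (A.output (c.state v)).isSome then (c.state v, fun _ => none)
  else A.step (c.state v) (List.ofFn fun i : Fin (A.coins (c.state v)) => ω (v, t, (i : ℕ)))
    (A.inbox N c v)

open Classical in
/-- The configuration after `t` rounds (rounds are numbered from `0`). Messages travel only along
edges of the graph. -/
noncomputable def run [Fintype V] (A : KT1LocalAlgorithm) (N : Network V) (ω : CoinTosses V) :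
    ℕ → A.Config V
  | 0 => { state := fun v => A.init (localInput N v), transit := fun _ _ => none }
  | t + 1 =>
    { state := fun v => (A.nodeStep N ω t (A.run N ω t) v).1
      transit := fun v w =>
        if N.graph.Adj v w then (A.nodeStep N ω t (A.run N ω t) v).2 (N.id w) else none }

open Classical in
/-- The number of messages sent by all nodes in round `t`. -/
noncomputable def messagesInRound [Fintype V] (A : KT1LocalAlgorithm) (N : Network V)
    (ω : CoinTosses V) (t : ℕ) : ℕ :=
  (Finset.univ.filter fun e : V × V => ((A.run N ω (t + 1)).transit e.1 e.2).isSome).card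

/-- The total number of messages sent throughout the execution is at most `M`. -/
def MessagesAtMost [Fintype V] (A : KT1LocalAlgorithm) (N : Network V) (ω : CoinTosses V)
    (M : ℝ) : Prop :=
  ∀ T : ℕ, ((∑ t ∈ Finset.range T, A.messagesInRound N ω t : ℕ) : ℝ) ≤ M

/-- After some number `T ≤ R` of rounds all nodes have halted, and a unique leader `ℓ` has been
elected: the output of every node is the identifier of `ℓ`. -/
def ElectsLeaderWithin [Fintype V] (A : KT1LocalAlgorithm) (N : Network V) (ω : CoinTosses V)
    (R : ℝ) : Prop :=
  ∃ T : ℕ, (T : ℝ) ≤ R ∧ ∃ l : V, ∀ v : V, A.output ((A.run N ω T).state v) = some (N.id l)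

end KT1LocalAlgorithm

/-! The algorithm builds a sparse spanner and then elects the leader by waves with echo on that
spanner.

Clusters. A node `v` with `h` leading heads among its `kk` coins has starting phase `start v = kk -
h`, and phase `q` begins in round `q ^ 2`. Clusters grow by one hop per phase, so `v` joins one in
phase `tau v`, the minimum of `start u + dist u v` over all `u` (`Phased`). A phase of `2 * q + 1`
rounds is long enough for the members to exchange their neighbour lists through the centre
(`member_known`). As these lists name the neighbours, the members then agree without further
messages on who contacts an outside node `x`: the member adjacent to `x` that joined first, with
ties broken by identifier. Thus a cluster spends one connection per outside node.

Spanner. An edge of the network is replaced by a detour through a cluster centre, of length at most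
`2 * K + 1` if all starting phases are at most `K = O(log n)` (`exists_walk_of_adj`). For the size,
a connection is charged to its end `x` and to a centre `z` with `start z + dist z x ≤ tau x + 2`
(`card_first_le`). By the memorylessness of leading heads, if there were `R` such centres, then
except with probability `(7/8)^R` one of them would show three more heads and undercut the minimum
`tau x` (`measure_gap_le`). So there are `O(n log n)` connections with high probability.

Waves. At least one and at most `O(log n)` nodes become candidates by their number of heads, and
each candidate floods the spanner. A node finishes its echo once all its peers have been reached and
those reached later have finished, so a finished echo at the candidate has collected the neighbour
lists of all nodes (`allKnown_of_done`). By connectivity a node recognises complete knowledge as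
closure under adjacency (`complete_iff`). It then halts with the smallest identifier and announces
what it knows, so the waves need not compete: each leads to the same output.

Cost. A node sends to its peers in `O(log^2 n)` rounds before it wakes up, and later only when it
joins a wave, finishes an echo or halts, which is `O(log n)` times (`card_sends_le`). The spanner
has diameter `O(D log n)`, which bounds the time (`electsLeader`). -/

/-! ### The algorithm -/

/-- The pieces of information that nodes exchange. Nodes are named by their identifiers. -/
inductive Item where
  /-- the node `i` has the set `nb` of neighbours -/
  | node (i : ℕ) (nb : Finset ℕ)
  /-- the node `i` with the set `nb` of neighbours has joined the cluster centred at `c`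
  in phase `q` -/
  | member (i : ℕ) (nb : Finset ℕ) (c q : ℕ)
  /-- the wave of the candidate `x` has reached the node `i` in round `r` -/
  | adopt (i x r : ℕ)
  /-- the node `i` has finished the echo of the wave of the candidate `x` -/
  | done (i x : ℕ)

namespace Item

/-- The node that creates a fact. -/
def owner : Item → ℕ
  | node i _ => i
  | member i _ _ _ => i
  | adopt i _ _ => i
  | done i _ => i

end Item

/-- The state of a node: its input, the number of the coming round, the number of leading heads
among its coins, the identifiers of its peers, the facts it knows, and its output. -/
structure NodeState where
  input : LocalInput
  round : ℕ
  heads : ℕ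
  peers : Set ℕ
  know : Set Item
  out : Option ℕ

/-- The number of leading heads in a sequence of coin tosses. -/
def leadingHeads (l : List Bool) : ℕ :=
  Nat.findGreatest (fun j => ∀ i < j, l.getD i false = true) l.length

namespace NodeState

/-- The number of leading heads, known after the round `0`. -/
def headsAfter (s : NodeState) (coins : List Bool) : ℕ :=
  if s.round = 0 then leadingHeads coins else s.heads

/-- All facts known after the receipt of the messages. -/
def received (s : NodeState) (m : ℕ → Option (Set Item)) : Set Item :=
  s.know ∪ {f | ∃ i K, m i = some K ∧ f ∈ K}

open Classical in
/-- A node which is not yet in a cluster joins the cluster of a sender, or opens its own cluster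
when its time has come. -/
noncomputable def joinFacts (s : NodeState) (start : ℕ) (m : ℕ → Option (Set Item)) : Set Item :=
  if ∃ nb c q, Item.member s.input.id nb c q ∈ s.received m then ∅
  else if h : ∃ cq : ℕ × ℕ, ∃ i K nb, m i = some K ∧ Item.member i nb cq.1 cq.2 ∈ K then
    {Item.member s.input.id s.input.nbrIds h.choose.1 (h.choose.2 + 1)}
  else if s.round = start ^ 2 then {Item.member s.input.id s.input.nbrIds s.input.id start}
  else ∅

/-- The facts known after the attempt to join a cluster. -/
noncomputable def clustered (s : NodeState) (start : ℕ) (m : ℕ → Option (Set Item)) : Set Item :=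
  s.received m ∪ s.joinFacts start m

/-- The neighbours to which a node has to connect its cluster, given the set `K` of known facts. -/
def pushTargets (s : NodeState) (K : Set Item) : Set ℕ :=
  {x | x ∈ s.input.nbrIds ∧ ∃ c q, Item.member s.input.id s.input.nbrIds c q ∈ K ∧
    -- This is the last round of phase `q`, so the message arrives in round `(q + 1) ^ 2`, exactly
    -- when the next phase begins.
    s.round + 1 = (q + 1) ^ 2 ∧ ∀ i nb q', Item.member i nb c q' ∈ K →
      i ≠ x ∧ (x ∈ nb → q < q' ∨ q = q' ∧ s.input.id ≤ i)}

/-- The peers after a round. -/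
def newPeers (s : NodeState) (m : ℕ → Option (Set Item)) (K : Set Item) : Set ℕ :=
  s.peers ∪ {i | (m i).isSome} ∪ s.pushTargets K

/-- The waves which reach a node in this round. -/
def adoptFacts (s : NodeState) (cand : Prop) (P : Set ℕ) (K : Set Item) : Set Item :=
  {f | ∃ x, f = Item.adopt s.input.id x s.round ∧ (∀ r, Item.adopt s.input.id x r ∉ K) ∧
    (x = s.input.id ∧ cand ∨ ∃ i ∈ P, ∃ r, Item.adopt i x r ∈ K)}

/-- The waves of which a node can finish the echo. -/
def doneFacts (s : NodeState) (P : Set ℕ) (K : Set Item) : Set Item :=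
  {f | ∃ x, f = Item.done s.input.id x ∧ ∃ r, Item.adopt s.input.id x r ∈ K ∧
    ∀ i ∈ P, ∃ r', Item.adopt i x r' ∈ K ∧ (r < r' → Item.done i x ∈ K)}

/-- The known facts after the treatment of waves and echos. -/
def waved (s : NodeState) (active cand : Prop) (P : Set ℕ) (K : Set Item) : Set Item :=
  {f | f ∈ K ∨ active ∧ f ∈ s.adoptFacts cand P K ∨
    active ∧ f ∈ s.doneFacts P (K ∪ s.adoptFacts cand P K)}

end NodeState

/-- The known nodes are closed under adjacency. -/
def Complete (K : Set Item) : Prop :=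
  ∀ i nb, Item.node i nb ∈ K → ∀ j ∈ nb, ∃ nb', Item.node j nb' ∈ K

open Classical in
/-- The round of a node: `start` is the phase in which it opens a cluster, `wake` the round in which
it becomes active, `thr` the number of heads that makes it a candidate. -/
noncomputable def nodeRound (kk wake thr : ℕ → ℕ) (s : NodeState) (coins : List Bool)
    (m : ℕ → Option (Set Item)) : NodeState × (ℕ → Option (Set Item)) :=
  let g := s.headsAfter coins
  let K := s.clustered (kk s.input.estimate - g) m
  let P := s.newPeers m K
  let active := wake s.input.estimate ≤ s.round
  let K' := s.waved active (thr s.input.estimate ≤ g) P K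
  let fin := active ∧ Complete K'
  ({ input := s.input
     round := s.round + 1
     heads := g
     peers := P
     know := K'
     out := if fin then some (sInf {i | ∃ nb, Item.node i nb ∈ K'}) else none },
    fun i => if i ∈ P ∧ (¬ active ∨ fin ∨ ∃ f ∈ K', f ∉ K) then some K' else none)

/-- The leader election algorithm with `kk N` coins, wake-up round `wake N` and threshold `thr N`
for candidates, at the estimate `N`. -/
noncomputable def electionAlgorithm (kk wake thr : ℕ → ℕ) : KT1LocalAlgorithm where
  State := NodeState
  Msg := Set Item
  init I := { input := I, round := 0, heads := 0, peers := ∅,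
              know := {Item.node I.id I.nbrIds}, out := none }
  output s := s.out
  coins s := if s.round = 0 then kk s.input.estimate else 0
  step := nodeRound kk wake thr

/-- The number of leading heads among the coins of the node `v`. -/
def nodeHeads {V : Type u} (kk : ℕ → ℕ) (N : Network V) (ω : CoinTosses V) (v : V) : ℕ :=
  leadingHeads (List.ofFn fun i : Fin (kk (N.estimate v)) => ω (v, 0, (i : ℕ)))

/-- The predicate maximised by `Nat.findGreatest` is downward closed. The count is truncated at the
number of coins, hence the restriction on `j`. -/
theorem le_nodeHeads_iff {V : Type u} {kk : ℕ → ℕ} {N : Network V} {ω : CoinTosses V} {v : V}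
    {j : ℕ} (hj : j ≤ kk (N.estimate v)) :
    j ≤ nodeHeads kk N ω v ↔ ∀ i < j, ω (v, 0, i) = true := by
  have key : ∀ j ≤ kk (N.estimate v), (∀ i < j, (List.ofFn fun i : Fin (kk (N.estimate v)) =>
      ω (v, 0, (i : ℕ))).getD i false = true) ↔ ∀ i < j, ω (v, 0, i) = true := by
    intro j hj
    refine forall₂_congr fun i hi => ?_
    have : i < kk (N.estimate v) := by omega
    simp [List.getD, this]
  unfold nodeHeads leadingHeads
  rw [List.length_ofFn]
  constructor
  · intro h i hi
    have h0 := Nat.findGreatest_spec (P := fun j => ∀ i < j,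
      (List.ofFn fun i : Fin (kk (N.estimate v)) => ω (v, 0, (i : ℕ))).getD i false = true)
      (Nat.zero_le (kk (N.estimate v))) (by simp)
    exact (key _ (Nat.findGreatest_le _)).1 h0 i (by omega)
  · intro h
    exact Nat.le_findGreatest hj ((key j hj).2 h)

/-! ### Executions -/

/-- An execution of the election algorithm in which every node starts its cluster in a positive
phase, and all nodes wake up between the rounds `lo` and `hi`, after the last phase. -/
structure Execution (V : Type u) [Fintype V] where
  N : Network V
  ω : CoinTosses V
  kk : ℕ → ℕ
  wake : ℕ → ℕ
  thr : ℕ → ℕ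
  connected : N.graph.Connected
  injective : Function.Injective N.id
  lo : ℕ
  hi : ℕ
  lo_le : ∀ v, lo ≤ wake (N.estimate v)
  le_hi : ∀ v, wake (N.estimate v) ≤ hi
  start_pos : ∀ v, 0 < kk (N.estimate v) - nodeHeads kk N ω v
  start_lt : ∀ v, (kk (N.estimate v) - nodeHeads kk N ω v + 1) ^ 2 < lo

namespace Execution

variable {V : Type u} [Fintype V] (E : Execution V)

/-- the identifier of a node -/
abbrev id (v : V) : ℕ := E.N.id v

/-- adjacency in the network -/
abbrev Adj (v w : V) : Prop := E.N.graph.Adj v w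

open Classical in
/-- the identifiers of the neighbours of a node -/
noncomputable def nbr (v : V) : Finset ℕ := (Finset.univ.filter fun w => E.Adj v w).image E.id

/-- the phase in which a node opens its own cluster unless it is in another one -/
def start (v : V) : ℕ := E.kk (E.N.estimate v) - nodeHeads E.kk E.N E.ω v

/-- the wake-up round -/
def wk (v : V) : ℕ := E.wake (E.N.estimate v)

/-- candidates for waves -/
def Cand (v : V) : Prop := E.thr (E.N.estimate v) ≤ nodeHeads E.kk E.N E.ω v

noncomputable def alg : KT1LocalAlgorithm := electionAlgorithm E.kk E.wake E.thr

noncomputable def st (t : ℕ) (v : V) : NodeState := (E.alg.run E.N E.ω t).state v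

/-- the message sent from `v` to `w` in the round before `t` -/
noncomputable def msg (t : ℕ) (v w : V) : Option (Set Item) := (E.alg.run E.N E.ω t).transit v w

noncomputable def know (t : ℕ) (v : V) : Set Item := (E.st t v).know

noncomputable def peers (t : ℕ) (v : V) : Set ℕ := (E.st t v).peers

/-- the node has not halted -/
def Running (t : ℕ) (v : V) : Prop := (E.st t v).out = none

noncomputable def inb (t : ℕ) (v : V) : ℕ → Option (Set Item) :=
  E.alg.inbox E.N (E.alg.run E.N E.ω t) v

/-- the facts known to `v` in round `t` after the receipt of messages -/
noncomputable def rcv (t : ℕ) (v : V) : Set Item := (E.st t v).received (E.inb t v)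

/-- the facts known to `v` in round `t` after the attempt to join a cluster -/
noncomputable def clu (t : ℕ) (v : V) : Set Item := (E.st t v).clustered (E.start v) (E.inb t v)

/-- the facts known to `v` in round `t` after the treatment of waves -/
noncomputable def ado (t : ℕ) (v : V) : Set Item :=
  E.clu t v ∪ (E.st t v).adoptFacts (E.Cand v) (E.peers (t + 1) v) (E.clu t v)

variable {E}

/-! ### Unfolding one round of an execution -/

theorem mem_nbr {v w : V} : E.id w ∈ E.nbr v ↔ E.Adj v w := by
  unfold nbr
  simp only [Finset.mem_image, Finset.mem_filter, Finset.mem_univ, true_and]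
  constructor
  · rintro ⟨u, hu, h⟩
    rwa [← E.injective h]
  · exact fun h => ⟨w, h, rfl⟩

theorem exists_of_mem_nbr {v : V} {i : ℕ} (h : i ∈ E.nbr v) : ∃ w, E.Adj v w ∧ E.id w = i := by
  unfold nbr at h
  simpa using h

theorem id_inj {v w : V} : E.id v = E.id w ↔ v = w := E.injective.eq_iff

theorem inb_id {t : ℕ} {u v : V} (h : E.Adj u v) : E.inb t v (E.id u) = E.msg t u v := by
  have hex : ∃ u', E.N.graph.Adj u' v ∧ E.N.id u' = E.N.id u := ⟨u, h, rfl⟩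
  unfold inb KT1LocalAlgorithm.inbox
  rw [dif_pos hex, E.injective hex.choose_spec.2]
  rfl

theorem exists_of_inb {t : ℕ} {v : V} {i : ℕ} {K : Set Item} (h : E.inb t v i = some K) :
    ∃ u, E.Adj u v ∧ E.id u = i ∧ E.msg t u v = some K := by
  by_cases hex : ∃ u', E.N.graph.Adj u' v ∧ E.N.id u' = i
  · obtain ⟨u, hu, rfl⟩ := hex
    exact ⟨u, hu, rfl, by rw [← inb_id hu]; exact h⟩
  · unfold inb KT1LocalAlgorithm.inbox at h
    rw [dif_neg hex] at h
    simp at h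

theorem st_succ_of_halted {t : ℕ} {v : V} (h : ¬ E.Running t v) : E.st (t + 1) v = E.st t v := by
  have : (E.alg.output ((E.alg.run E.N E.ω t).state v)).isSome := by
    rw [Option.isSome_iff_ne_none]; exact h
  change (KT1LocalAlgorithm.nodeStep _ _ _ _ _ v).1 = _
  unfold KT1LocalAlgorithm.nodeStep
  rw [if_pos this]
  rfl

open Classical in
theorem msg_succ_of_halted {t : ℕ} {v w : V} (h : ¬ E.Running t v) : E.msg (t + 1) v w = none := by
  have : (E.alg.output ((E.alg.run E.N E.ω t).state v)).isSome := by
    rw [Option.isSome_iff_ne_none]; exact h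
  change (if _ then (KT1LocalAlgorithm.nodeStep _ _ _ _ _ v).2 _ else none) = _
  unfold KT1LocalAlgorithm.nodeStep
  rw [if_pos this]
  exact ite_self _

theorem running_of_le {t t' : ℕ} {v : V} (h : t ≤ t') (hr : E.Running t' v) : E.Running t v := by
  induction t', h using Nat.le_induction with
  | base => exact hr
  | succ t' _ ih =>
    refine ih ?_
    by_contra hn
    have := st_succ_of_halted hn
    unfold Running at hr hn
    rw [this] at hr
    exact hn hr

theorem nodeStep_of_running {t : ℕ} {v : V} (h : E.Running t v) :
    E.alg.nodeStep E.N E.ω t (E.alg.run E.N E.ω t) v = nodeRound E.kk E.wake E.thr (E.st t v)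
      (List.ofFn fun i : Fin (E.alg.coins (E.st t v)) => E.ω (v, t, (i : ℕ))) (E.inb t v) := by
  have : ¬ (E.alg.output ((E.alg.run E.N E.ω t).state v)).isSome := by
    rw [Option.isSome_iff_ne_none, not_not]; exact h
  unfold KT1LocalAlgorithm.nodeStep
  rw [if_neg this]
  rfl

theorem st_succ {t : ℕ} {v : V} (h : E.Running t v) :
    E.st (t + 1) v = (nodeRound E.kk E.wake E.thr (E.st t v)
      (List.ofFn fun i : Fin (E.alg.coins (E.st t v)) => E.ω (v, t, (i : ℕ))) (E.inb t v)).1 := by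
  rw [← nodeStep_of_running h]
  rfl

theorem input_eq (t : ℕ) (v : V) : (E.st t v).input = KT1LocalAlgorithm.localInput E.N v := by
  induction t with
  | zero => rfl
  | succ t ih =>
    by_cases h : E.Running t v
    · rw [st_succ h]; exact ih
    · rw [st_succ_of_halted h]; exact ih

theorem input_id (t : ℕ) (v : V) : (E.st t v).input.id = E.id v := by rw [input_eq]; rfl
theorem input_nbr (t : ℕ) (v : V) : (E.st t v).input.nbrIds = E.nbr v := by rw [input_eq]; rfl
theorem input_est (t : ℕ) (v : V) : (E.st t v).input.estimate = E.N.estimate v := by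
  rw [input_eq]; rfl

theorem round_eq {t : ℕ} {v : V} (h : E.Running t v) : (E.st t v).round = t := by
  induction t with
  | zero => rfl
  | succ t ih =>
    have h' := running_of_le (Nat.le_succ t) h
    rw [st_succ h', ← ih h']
    rw [ih h']
    exact congrArg (· + 1) (ih h')

theorem heads_eq {t : ℕ} {v : V} (h : E.Running t v) :
    (E.st t v).headsAfter (List.ofFn fun i : Fin (E.alg.coins (E.st t v)) =>
      E.ω (v, t, (i : ℕ))) = nodeHeads E.kk E.N E.ω v := by
  induction t with
  | zero => rfl
  | succ t ih =>
    have h' := running_of_le (Nat.le_succ t) h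
    have : (E.st (t + 1) v).heads = nodeHeads E.kk E.N E.ω v := by
      rw [st_succ h']; exact ih h'
    unfold NodeState.headsAfter
    rw [round_eq h, if_neg (Nat.succ_ne_zero t), this]

theorem know_zero (v : V) : E.know 0 v = {Item.node (E.id v) (E.nbr v)} := rfl

theorem peers_zero (v : V) : E.peers 0 v = ∅ := rfl

theorem msg_zero (v w : V) : E.msg 0 v w = none := rfl

theorem running_zero (v : V) : E.Running 0 v := rfl

theorem peers_succ {t : ℕ} {v : V} (h : E.Running t v) :
    E.peers (t + 1) v = (E.st t v).newPeers (E.inb t v) (E.clu t v) := by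
  unfold peers
  rw [st_succ h]
  simp only [nodeRound, heads_eq h, input_est]
  rfl

theorem know_succ {t : ℕ} {v : V} (h : E.Running t v) :
    E.know (t + 1) v = (E.st t v).waved (E.wk v ≤ t) (E.Cand v) (E.peers (t + 1) v)
      (E.clu t v) := by
  rw [peers_succ h]
  unfold know
  rw [st_succ h]
  simp only [nodeRound, heads_eq h, input_est, round_eq h]
  rfl

/-- the node sends messages in round `t` -/
def Sends (E : Execution V) (t : ℕ) (v : V) : Prop :=
  t < E.wk v ∨ (E.wk v ≤ t ∧ Complete (E.know (t + 1) v)) ∨ ∃ f ∈ E.know (t + 1) v, f ∉ E.clu t v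

open Classical in
theorem out_succ {t : ℕ} {v : V} (h : E.Running t v) :
    (E.st (t + 1) v).out = if E.wk v ≤ t ∧ Complete (E.know (t + 1) v) then
      some (sInf {i | ∃ nb, Item.node i nb ∈ E.know (t + 1) v}) else none := by
  rw [know_succ h, peers_succ h]
  rw [st_succ h]
  simp only [nodeRound, heads_eq h, input_est, round_eq h]
  rfl

open Classical in
theorem msg_succ {t : ℕ} {v w : V} (h : E.Running t v) (ha : E.Adj v w) :
    E.msg (t + 1) v w = if E.id w ∈ E.peers (t + 1) v ∧ E.Sends t v then
      some (E.know (t + 1) v) else none := by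
  change (if E.Adj v w then (KT1LocalAlgorithm.nodeStep _ _ _ _ _ v).2 (E.id w) else none) = _
  rw [if_pos ha, nodeStep_of_running h]
  unfold Sends
  rw [know_succ h, peers_succ h]
  simp only [nodeRound, heads_eq h, input_est, round_eq h, ← not_le]
  rfl

open Classical in
theorem adj_of_msg {t : ℕ} {v w : V} {K : Set Item} (h : E.msg t v w = some K) : E.Adj v w := by
  cases t with
  | zero => simp [msg_zero] at h
  | succ t =>
    by_contra ha
    change (if E.Adj v w then (KT1LocalAlgorithm.nodeStep _ _ _ _ _ v).2 (E.id w) else none) = _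
      at h
    rw [if_neg ha] at h
    simp at h

theorem of_msg_succ {t : ℕ} {v w : V} {K : Set Item} (h : E.msg (t + 1) v w = some K) :
    E.Running t v ∧ E.id w ∈ E.peers (t + 1) v ∧ E.Sends t v ∧ K = E.know (t + 1) v := by
  have hr : E.Running t v := by
    by_contra hn
    rw [msg_succ_of_halted hn] at h
    simp at h
  rw [msg_succ hr (adj_of_msg h)] at h
  split_ifs at h with hc
  exact ⟨hr, hc.1, hc.2, (Option.some.inj h).symm⟩

theorem of_msg {t : ℕ} {v w : V} {K : Set Item} (h : E.msg t v w = some K) :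
    E.id w ∈ E.peers t v ∧ K = E.know t v := by
  cases t with
  | zero => simp [msg_zero] at h
  | succ t => exact ⟨(of_msg_succ h).2.1, (of_msg_succ h).2.2.2⟩

theorem mem_rcv {t : ℕ} {v : V} {f : Item} :
    f ∈ E.rcv t v ↔ f ∈ E.know t v ∨ ∃ u K, E.msg t u v = some K ∧ f ∈ K := by
  refine or_congr Iff.rfl ⟨?_, ?_⟩
  · rintro ⟨i, K, hK, hf⟩
    obtain ⟨u, -, -, hu⟩ := exists_of_inb hK
    exact ⟨u, K, hu, hf⟩
  · rintro ⟨u, K, hK, hf⟩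
    exact ⟨E.id u, K, by rw [inb_id (adj_of_msg hK), hK], hf⟩

theorem rcv_subset_clu (t : ℕ) (v : V) : E.rcv t v ⊆ E.clu t v := Set.subset_union_left

theorem know_subset_rcv (t : ℕ) (v : V) : E.know t v ⊆ E.rcv t v := Set.subset_union_left

theorem clu_subset {t : ℕ} {v : V} (h : E.Running t v) : E.clu t v ⊆ E.know (t + 1) v := by
  rw [know_succ h]
  exact fun f hf => Or.inl hf

theorem know_subset_succ (t : ℕ) (v : V) : E.know t v ⊆ E.know (t + 1) v := by
  by_cases h : E.Running t v
  · exact ((know_subset_rcv t v).trans (rcv_subset_clu t v)).trans (clu_subset h)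
  · unfold know; rw [st_succ_of_halted h]

theorem know_mono {t t' : ℕ} (h : t ≤ t') (v : V) : E.know t v ⊆ E.know t' v := by
  induction t', h using Nat.le_induction with
  | base => exact subset_rfl
  | succ t' _ ih => exact ih.trans (know_subset_succ t' v)

theorem mem_peers_succ {t : ℕ} {v : V} (h : E.Running t v) {i : ℕ} :
    i ∈ E.peers (t + 1) v ↔ i ∈ E.peers t v ∨
      (∃ u K, E.id u = i ∧ E.msg t u v = some K) ∨ i ∈ (E.st t v).pushTargets (E.clu t v) := by
  rw [peers_succ h]
  unfold NodeState.newPeers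
  rw [Set.union_assoc]
  refine or_congr Iff.rfl (or_congr ⟨?_, ?_⟩ Iff.rfl)
  · intro hi
    obtain ⟨K, hK⟩ := Option.isSome_iff_exists.1 hi
    obtain ⟨u, -, hu, hu'⟩ := exists_of_inb hK
    exact ⟨u, K, hu, hu'⟩
  · rintro ⟨u, K, rfl, hK⟩
    show (E.inb t v (E.id u)).isSome
    rw [inb_id (adj_of_msg hK), hK]
    rfl

theorem peers_subset_succ (t : ℕ) (v : V) : E.peers t v ⊆ E.peers (t + 1) v := by
  by_cases h : E.Running t v
  · exact fun i hi => (mem_peers_succ h).2 (Or.inl hi)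
  · unfold peers; rw [st_succ_of_halted h]

theorem peers_mono {t t' : ℕ} (h : t ≤ t') (v : V) : E.peers t v ⊆ E.peers t' v := by
  induction t', h using Nat.le_induction with
  | base => exact subset_rfl
  | succ t' _ ih => exact ih.trans (peers_subset_succ t' v)

theorem mem_pushTargets {t : ℕ} {v : V} (h : E.Running t v) {x : ℕ} :
    x ∈ (E.st t v).pushTargets (E.clu t v) ↔ x ∈ E.nbr v ∧ ∃ c q,
      Item.member (E.id v) (E.nbr v) c q ∈ E.clu t v ∧ t + 1 = (q + 1) ^ 2 ∧
      ∀ i nb q', Item.member i nb c q' ∈ E.clu t v →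
        i ≠ x ∧ (x ∈ nb → q < q' ∨ q = q' ∧ E.id v ≤ i) := by
  simp only [NodeState.pushTargets, Set.mem_ofPred_eq, input_id, input_nbr, round_eq h]

theorem exists_of_mem_peers {t : ℕ} {v : V} {i : ℕ} (h : i ∈ E.peers t v) :
    ∃ w, E.Adj v w ∧ E.id w = i := by
  induction t with
  | zero => simp [peers_zero] at h
  | succ t ih =>
    by_cases hr : E.Running t v
    · rcases (mem_peers_succ hr).1 h with h | ⟨u, K, hu, hK⟩ | h
      · exact ih h
      · exact ⟨u, (adj_of_msg hK).symm, hu⟩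
      · exact exists_of_mem_nbr ((mem_pushTargets hr).1 h).1
    · refine ih ?_
      unfold peers at h ⊢
      rwa [st_succ_of_halted hr] at h

theorem adj_of_mem_peers {t : ℕ} {v w : V} (h : E.id w ∈ E.peers t v) : E.Adj v w := by
  obtain ⟨u, hu, h'⟩ := exists_of_mem_peers h
  rwa [← id_inj.1 h']

/-- Facts are created by their owners. -/
theorem owner_know {t : ℕ} {v : V} {f : Item} (h : f ∈ E.know t v) :
    ∃ u, E.id u = f.owner ∧ f ∈ E.know t u := by
  induction t generalizing v with
  | zero =>
    rw [know_zero] at h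
    refine ⟨v, ?_, h⟩
    rw [Set.mem_singleton_iff.1 h]
    rfl
  | succ t ih =>
    by_cases hr : E.Running t v
    · have h0 := h
      rw [know_succ hr] at h
      have own : f.owner = E.id v → ∃ u, E.id u = f.owner ∧ f ∈ E.know (t + 1) u :=
        fun hf => ⟨v, hf.symm, h0⟩
      rcases h with (h | h) | ⟨-, x, rfl, -⟩ | ⟨-, x, rfl, -⟩
      · obtain ⟨u, hf⟩ : ∃ u, f ∈ E.know t u := by
          rcases mem_rcv.1 h with h | ⟨u, K, hK, hf⟩
          · exact ⟨v, h⟩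
          · exact ⟨u, (of_msg hK).2 ▸ hf⟩
        obtain ⟨w, hw, hf⟩ := ih hf
        exact ⟨w, hw, know_subset_succ t w hf⟩
      · unfold NodeState.joinFacts at h
        split_ifs at h with h1 h2 h3
        · simp at h
        · exact own (by rw [Set.mem_singleton_iff.1 h]; exact input_id t v)
        · exact own (by rw [Set.mem_singleton_iff.1 h]; exact input_id t v)
        · simp at h
      · exact own (input_id t v)
      · exact own (input_id t v)
    · unfold know at h
      rw [st_succ_of_halted hr] at h
      obtain ⟨w, hw, hf⟩ := ih h
      exact ⟨w, hw, know_subset_succ t w hf⟩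

theorem owner_rcv {t : ℕ} {v : V} {f : Item} (h : f ∈ E.rcv t v) :
    ∃ u, E.id u = f.owner ∧ f ∈ E.know t u := by
  rcases mem_rcv.1 h with h | ⟨u, K, hK, hf⟩
  · exact owner_know h
  · rw [(of_msg hK).2] at hf
    exact owner_know hf

/-- A fact is never known to anyone before its owner, so messages teach a node nothing new about
itself. -/
theorem own_of_mem_rcv {t : ℕ} {v : V} {f : Item} (h : f ∈ E.rcv t v) (hv : f.owner = E.id v) :
    f ∈ E.know t v := by
  obtain ⟨u, hu, hf⟩ := owner_rcv h
  rwa [id_inj.1 (hu.trans hv)] at hf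

theorem own_know {t t' : ℕ} {v w : V} {f : Item} (h : f ∈ E.know t v) (hw : f.owner = E.id w)
    (htt : t ≤ t') : f ∈ E.know t' w := by
  obtain ⟨u, hu, hf⟩ := owner_know h
  rw [id_inj.1 (hu.trans hw)] at hf
  exact know_mono htt w hf

/-- Messages of `v` reach the peers of `v`. -/
theorem know_subset_of_sends {t : ℕ} {v w : V} (hv : E.Running t v) (hw : E.Running (t + 1) w)
    (hp : E.id w ∈ E.peers (t + 1) v) (hs : E.Sends t v) :
    E.know (t + 1) v ⊆ E.rcv (t + 1) w ∧ E.id v ∈ E.peers (t + 2) w := by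
  have hm : E.msg (t + 1) v w = some (E.know (t + 1) v) := by
    rw [msg_succ hv (adj_of_mem_peers hp), if_pos ⟨hp, hs⟩]
  exact ⟨fun f hf => mem_rcv.2 (Or.inr ⟨v, _, hm, hf⟩),
    (mem_peers_succ hw).2 (Or.inr (Or.inl ⟨v, _, rfl, hm⟩))⟩

theorem running_of_le_wk {t : ℕ} {v : V} (h : t ≤ E.wk v) : E.Running t v := by
  induction t with
  | zero => exact running_zero v
  | succ t ih =>
    have hr := ih (by omega)
    unfold Running
    rw [out_succ hr, if_neg]
    rintro ⟨h', -⟩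
    omega

theorem running_of_le_lo {t : ℕ} (h : t ≤ E.lo) (v : V) : E.Running t v :=
  running_of_le_wk (h.trans (E.lo_le v))

theorem know_succ_of_lt {t : ℕ} (h : t < E.lo) (v : V) : E.know (t + 1) v = E.clu t v := by
  rw [know_succ (running_of_le_lo h.le v)]
  have : ¬ E.wk v ≤ t := not_le.2 (h.trans_le (E.lo_le v))
  simp [NodeState.waved, this]

end Execution

namespace Execution

variable {V : Type u} [Fintype V] {E : Execution V}

/-! ### The phases in which nodes join clusters -/

/-- The phase in which a node joins a cluster. -/
noncomputable def tau (E : Execution V) (v : V) : ℕ :=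
  sInf (Set.range fun u => E.start u + E.N.graph.dist u v)

theorem tau_le (u v : V) : E.tau v ≤ E.start u + E.N.graph.dist u v := Nat.sInf_le ⟨u, rfl⟩

theorem exists_tau_eq (v : V) : ∃ u, E.start u + E.N.graph.dist u v = E.tau v :=
  Nat.sInf_mem (s := Set.range fun u => E.start u + E.N.graph.dist u v) ⟨_, ⟨v, rfl⟩⟩

theorem tau_le_start (v : V) : E.tau v ≤ E.start v := by simpa using tau_le (E := E) v v

theorem dist_le_dist_add_one {u v w : V} (h : E.Adj v w) :
    E.N.graph.dist u w ≤ E.N.graph.dist u v + 1 := by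
  have := E.connected.dist_triangle (u := u) (v := v) (w := w)
  rwa [SimpleGraph.dist_eq_one_iff_adj.2 h] at this

theorem tau_adj {v w : V} (h : E.Adj v w) : E.tau w ≤ E.tau v + 1 := by
  obtain ⟨u, hu⟩ := exists_tau_eq (E := E) v
  have := dist_le_dist_add_one (u := u) h
  have := tau_le (E := E) u w
  omega

/-- On a shortest path from `v` to a minimising `u`, the first step leads to a node whose phase is
exactly one smaller. Hence clusters can grow along edges. -/
theorem tau_eq_start_or (v : V) :
    E.tau v = E.start v ∨ ∃ y, E.Adj y v ∧ E.tau y + 1 = E.tau v := by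
  obtain ⟨u, hu⟩ := exists_tau_eq (E := E) v
  obtain ⟨p, hp⟩ := (E.connected v u).exists_walk_length_eq_dist
  cases p with
  | nil => left; simpa using hu.symm
  | @cons _ y _ h q =>
    right
    refine ⟨y, h.symm, ?_⟩
    rw [SimpleGraph.Walk.length_cons, SimpleGraph.dist_comm] at hp
    have h1 := tau_le (E := E) u y
    have h2 := SimpleGraph.dist_le q
    rw [SimpleGraph.dist_comm] at h2
    have h3 := tau_adj (E := E) h.symm
    omega

theorem tau_pos (v : V) : 0 < E.tau v := by
  obtain ⟨u, hu⟩ := exists_tau_eq (E := E) v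
  have : 0 < E.start u := E.start_pos u
  omega

theorem tau_lt_lo (v : V) : (E.tau v + 1) ^ 2 < E.lo :=
  (Nat.pow_le_pow_left (Nat.succ_le_succ (tau_le_start v)) 2).trans_lt (E.start_lt v)

/-! ### Joining a cluster -/

theorem joinFacts_cases {t : ℕ} {v : V} {f : Item} (hr : E.Running t v)
    (h : f ∈ (E.st t v).joinFacts (E.start v) (E.inb t v)) :
    (∀ nb c q, Item.member (E.id v) nb c q ∉ E.know t v) ∧
    ((∃ u K nb c q, E.msg t u v = some K ∧ Item.member (E.id u) nb c q ∈ K ∧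
      f = Item.member (E.id v) (E.nbr v) c (q + 1)) ∨
    (t = E.start v ^ 2 ∧ f = Item.member (E.id v) (E.nbr v) (E.id v) (E.start v))) := by
  unfold NodeState.joinFacts at h
  rw [input_id, input_nbr, round_eq hr] at h
  split_ifs at h with h1 h2 h3
  · simp at h
  · refine ⟨fun nb c q hm => h1 ⟨nb, c, q, know_subset_rcv t v hm⟩, Or.inl ?_⟩
    obtain ⟨i, K, nb, hK, hf⟩ := h2.choose_spec
    obtain ⟨u, -, rfl, hu⟩ := exists_of_inb hK
    exact ⟨u, K, nb, _, _, hu, hf, h⟩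
  · exact ⟨fun nb c q hm => h1 ⟨nb, c, q, know_subset_rcv t v hm⟩, Or.inr ⟨h3, h⟩⟩
  · simp at h

theorem joinFacts_unique {t : ℕ} {v : V} {f f' : Item}
    (h : f ∈ (E.st t v).joinFacts (E.start v) (E.inb t v))
    (h' : f' ∈ (E.st t v).joinFacts (E.start v) (E.inb t v)) : f = f' := by
  unfold NodeState.joinFacts at h h'
  split_ifs at h h' with h1 h2 h3
  · simp at h
  · exact h.trans h'.symm
  · exact h.trans h'.symm
  · simp at h

theorem exists_joinFacts {t : ℕ} {v : V} (hr : E.Running t v)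
    (h : ∀ nb c q, Item.member (E.id v) nb c q ∉ E.know t v)
    (h' : (∃ u K nb c q, E.msg t u v = some K ∧ Item.member (E.id u) nb c q ∈ K) ∨
      t = E.start v ^ 2) :
    ∃ c q, Item.member (E.id v) (E.nbr v) c q ∈
      (E.st t v).joinFacts (E.start v) (E.inb t v) := by
  unfold NodeState.joinFacts
  rw [input_id, input_nbr, round_eq hr]
  rw [if_neg (by rintro ⟨nb, c, q, hm⟩; exact h nb c q (own_of_mem_rcv hm rfl))]
  by_cases h2 : ∃ cq : ℕ × ℕ, ∃ i K nb, E.inb t v i = some K ∧ Item.member i nb cq.1 cq.2 ∈ K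
  · rw [dif_pos h2]
    exact ⟨_, _, rfl⟩
  · rw [dif_neg h2]
    rcases h' with ⟨u, K, nb, c, q, hK, hf⟩ | h'
    · exact absurd ⟨(c, q), E.id u, K, nb, by rw [inb_id (adj_of_msg hK), hK], hf⟩ h2
    · rw [if_pos h']
      exact ⟨_, _, rfl⟩

theorem member_know_succ {t : ℕ} (ht : t < E.lo) {v : V} {nb : Finset ℕ} {c q : ℕ}
    (h : Item.member (E.id v) nb c q ∈ E.know (t + 1) v) :
    Item.member (E.id v) nb c q ∈ E.know t v ∨
      Item.member (E.id v) nb c q ∈ (E.st t v).joinFacts (E.start v) (E.inb t v) := by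
  rw [know_succ_of_lt ht] at h
  exact h.imp (fun h => own_of_mem_rcv h rfl) fun h => h

theorem sends_of_lt_lo {t : ℕ} (ht : t < E.lo) (v : V) : E.Sends t v :=
  Or.inl (ht.trans_le (E.lo_le v))

/-- In the first stage, all knowledge is passed on to the peers in every round. -/
theorem know_subset_of_peer {t : ℕ} (h0 : 0 < t) (ht : t < E.lo) {v w : V}
    (hp : E.id w ∈ E.peers t v) :
    E.know t v ⊆ E.know (t + 1) w ∧ E.id v ∈ E.peers (t + 1) w := by
  obtain ⟨t, rfl⟩ := Nat.exists_eq_succ_of_ne_zero h0.ne'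
  have hr := running_of_le_lo (E := E) ht.le w
  have := know_subset_of_sends (running_of_le_lo (by omega) v) hr hp
    (sends_of_lt_lo (by omega) v)
  exact ⟨(this.1.trans (rcv_subset_clu _ w)).trans (clu_subset hr), this.2⟩

/-- The node `v` has joined the cluster centred at the node with identifier `c`. -/
def InCluster (E : Execution V) (t : ℕ) (v : V) (c : ℕ) : Prop :=
  Item.member (E.id v) (E.nbr v) c (E.tau v) ∈ E.know t v

/-- The state of affairs before round `t` of the first stage. -/
structure Phased (E : Execution V) (t : ℕ) : Prop where
  joined : ∀ v, (∃ c, E.InCluster t v c) ↔ E.tau v ^ 2 < t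
  member : ∀ v nb c q, Item.member (E.id v) nb c q ∈ E.know t v → nb = E.nbr v ∧ q = E.tau v
  unique : ∀ v c c', E.InCluster t v c → E.InCluster t v c' → c = c'
  -- No connection to `x` exists before round `tau x ^ 2`, and one present at that moment comes from
  -- the preceding phase. So no message makes `x` join too early or with a wrong phase.
  peer : ∀ u x, E.id x ∈ E.peers t u → E.tau u ^ 2 < t ∧ E.tau x ^ 2 ≤ t ∧
    (E.tau x ^ 2 = t → E.tau u + 1 = E.tau x)
  parent : ∀ v c, E.InCluster t v c → (c = E.id v ∧ E.tau v = E.start v) ∨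
    ∃ w, E.tau w + 1 = E.tau v ∧ E.InCluster t w c ∧ E.id v ∈ E.peers (E.tau v ^ 2) w ∧
      E.id w ∈ E.peers (E.tau v ^ 2 + 1) v

theorem InCluster.mono {t t' : ℕ} (h : t ≤ t') {v : V} {c : ℕ} (hm : E.InCluster t v c) :
    E.InCluster t' v c := know_mono h v hm

theorem Phased.of_member {t : ℕ} (I : E.Phased t) {v : V} {i : ℕ} {nb : Finset ℕ} {c q : ℕ}
    (h : Item.member i nb c q ∈ E.know t v) :
    ∃ u, E.id u = i ∧ nb = E.nbr u ∧ q = E.tau u ∧ E.InCluster t u c := by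
  obtain ⟨u, hu, hm⟩ := owner_know h
  obtain rfl : E.id u = i := hu
  obtain ⟨rfl, rfl⟩ := I.member u nb c q hm
  exact ⟨u, rfl, rfl, rfl, hm⟩

/-- A cluster connects to a node outside as soon as it is adjacent to it. -/
theorem Phased.exists_push {t : ℕ} (I : E.Phased t) (hlo : t ≤ E.lo) {y x : V} {c : ℕ}
    (hy : E.InCluster t y c) (ht : t = (E.tau y + 1) ^ 2) (hyx : E.Adj y x)
    (hx : ¬ E.InCluster t x c)
    (hmin : ∀ u, E.InCluster t u c → E.Adj u x → E.tau y ≤ E.tau u) :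
    ∃ w, E.InCluster t w c ∧ E.tau w = E.tau y ∧ E.id x ∈ E.peers t w := by
  obtain ⟨s, rfl⟩ : ∃ s, t = s + 1 := Nat.exists_eq_succ_of_ne_zero (by rw [ht]; positivity)
  classical
  -- Among the adjacent members of minimal phase, the one with the smallest identifier passes the
  -- push test. Only soundness of its knowledge matters here: all members it knows of are genuine,
  -- hence not better placed. Missing knowledge could only create superfluous connections.
  obtain ⟨w, hw, hwmin⟩ := Finset.exists_min_image (Finset.univ.filter fun w =>
    E.InCluster (s + 1) w c ∧ E.tau w = E.tau y ∧ E.Adj w x) E.id ⟨y, by simp [hy, hyx]⟩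
  simp only [Finset.mem_filter, Finset.mem_univ, true_and] at hw hwmin
  obtain ⟨hwc, hwt, hwx⟩ := hw
  have hr : E.Running s w := running_of_le_lo (by omega) w
  refine ⟨w, hwc, hwt, (mem_peers_succ hr).2 (Or.inr (Or.inr ((mem_pushTargets hr).2 ?_)))⟩
  rw [← know_succ_of_lt (by omega)]
  refine ⟨mem_nbr.2 hwx, c, E.tau w, hwc, by rw [hwt]; exact ht, fun i nb q' hm => ?_⟩
  obtain ⟨u, rfl, rfl, rfl, hu⟩ := I.of_member hm
  refine ⟨fun h => hx ((id_inj.1 h) ▸ hu), fun hux => ?_⟩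
  have hux := mem_nbr.1 hux
  rcases (hmin u hu hux).lt_or_eq with h | h
  · exact Or.inl (hwt ▸ h)
  · exact Or.inr ⟨hwt.trans h, hwmin u ⟨hu, h.symm, hux⟩⟩

theorem sq_injective {a b : ℕ} (h : a ^ 2 = b ^ 2) : a = b :=
  Nat.pow_left_injective two_ne_zero h

theorem sq_mono {a b : ℕ} (h : a ≤ b) : a ^ 2 ≤ b ^ 2 := Nat.pow_le_pow_left h 2

/-- A clustered node does not join again, so joining cannot happen after round `tau v ^ 2`. It
cannot happen earlier either, by the invariant `peer` for messages and by `tau v ≤ start v` for a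
node opening its own cluster. -/
theorem Phased.join_value {t : ℕ} (I : E.Phased t) {v : V} {f : Item} (hr : E.Running t v)
    (h : f ∈ (E.st t v).joinFacts (E.start v) (E.inb t v)) :
    t = E.tau v ^ 2 ∧ ∃ c, f = Item.member (E.id v) (E.nbr v) c (E.tau v) ∧
      ((c = E.id v ∧ E.tau v = E.start v) ∨ ∃ w, E.tau w + 1 = E.tau v ∧ E.InCluster t w c ∧
        E.id v ∈ E.peers t w ∧ E.id w ∈ E.peers (t + 1) v) := by
  obtain ⟨hn, hf⟩ := joinFacts_cases hr h
  have hle : t ≤ E.tau v ^ 2 := by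
    by_contra hlt
    obtain ⟨c, hc⟩ := (I.joined v).2 (not_le.1 hlt)
    exact hn _ _ _ hc
  rcases hf with ⟨u, K, nb, c, q, hK, hm, rfl⟩ | ⟨ht, rfl⟩
  · obtain ⟨hp, rfl⟩ := of_msg hK
    obtain ⟨h1, h2, h3⟩ := I.peer u v hp
    have ht : E.tau v ^ 2 = t := le_antisymm h2 hle
    obtain ⟨rfl, rfl⟩ := I.member u nb c q hm
    refine ⟨ht.symm, c, by rw [h3 ht], Or.inr ⟨u, h3 ht, hm, hp, ?_⟩⟩
    exact (mem_peers_succ hr).2 (Or.inr (Or.inl ⟨u, _, rfl, hK⟩))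
  · have hs : E.tau v = E.start v := sq_injective
      (le_antisymm (sq_mono (tau_le_start v)) (ht ▸ hle))
    exact ⟨hs ▸ ht, E.id v, by rw [hs], Or.inl ⟨rfl, hs⟩⟩

theorem phased_zero : E.Phased 0 where
  joined v := by simp [InCluster, know_zero]
  member v nb c q h := by simp [know_zero] at h
  unique v c c' h := by simp [InCluster, know_zero] at h
  peer u x h := by simp [peers_zero] at h
  parent v c h := by simp [InCluster, know_zero] at h

theorem Phased.succ {t : ℕ} (I : E.Phased t) (ht : t < E.lo) : E.Phased (t + 1) := by
  have hr := running_of_le_lo (E := E) ht.le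
  have hmember : ∀ v nb c q, Item.member (E.id v) nb c q ∈ E.know (t + 1) v →
      nb = E.nbr v ∧ q = E.tau v ∧ E.tau v ^ 2 < t + 1 := by
    intro v nb c q h
    rcases member_know_succ ht h with h | h
    · obtain ⟨rfl, rfl⟩ := I.member v nb c q h
      exact ⟨rfl, rfl, ((I.joined v).1 ⟨c, h⟩).trans (Nat.lt_succ_self t)⟩
    · obtain ⟨hs, c', hf, -⟩ := I.join_value (hr v) h
      cases hf
      exact ⟨rfl, rfl, by omega⟩
  refine ⟨fun v => ⟨fun ⟨c, hc⟩ => (hmember v _ _ _ hc).2.2, fun hlt => ?_⟩,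
    fun v nb c q h => ⟨(hmember v nb c q h).1, (hmember v nb c q h).2.1⟩,
    fun v c c' h h' => ?_, fun u x hx => ?_, fun v c hc => ?_⟩
  · by_cases hlt' : E.tau v ^ 2 < t
    · obtain ⟨c, hc⟩ := (I.joined v).2 hlt'
      exact ⟨c, hc.mono (Nat.le_succ t)⟩
    · have hte : t = E.tau v ^ 2 := by omega
      have hn : ∀ nb c q, Item.member (E.id v) nb c q ∉ E.know t v := by
        intro nb c q hm
        obtain ⟨rfl, rfl⟩ := I.member v nb c q hm
        exact hlt' ((I.joined v).1 ⟨c, hm⟩)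
      have hc : ∃ c q, Item.member (E.id v) (E.nbr v) c q ∈
          (E.st t v).joinFacts (E.start v) (E.inb t v) := by
        refine exists_joinFacts (hr v) hn ?_
        rcases tau_eq_start_or (E := E) v with h | ⟨y, hyv, hy⟩
        · exact Or.inr (h ▸ hte)
        · left
          -- The predecessor `y` need not contact `v` itself, but some member `w` of its cluster
          -- with the same phase does, and the message carries the membership of `w`.
          have hty : t = (E.tau y + 1) ^ 2 := by rw [hy]; exact hte
          obtain ⟨c, hc⟩ := (I.joined y).2
            (by rw [hty]; exact Nat.pow_lt_pow_left (Nat.lt_succ_self _) two_ne_zero)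
          obtain ⟨w, hwc, hwt, hp⟩ := I.exists_push ht.le hc hty hyv
            (fun h => hn _ _ _ h) (fun u _ hu => by have := tau_adj hu; omega)
          obtain ⟨s, rfl⟩ : ∃ s, t = s + 1 :=
            Nat.exists_eq_succ_of_ne_zero (by rw [hty]; positivity)
          have hm : E.msg (s + 1) w v = some (E.know (s + 1) w) := by
            rw [msg_succ (running_of_le_lo (by omega) w) (adj_of_mem_peers hp),
              if_pos ⟨hp, sends_of_lt_lo (by omega) w⟩]
          exact ⟨w, _, _, _, _, hm, hwc⟩
      obtain ⟨c, q, hc⟩ := hc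
      have hk : Item.member (E.id v) (E.nbr v) c q ∈ E.know (t + 1) v := by
        rw [know_succ_of_lt ht]; exact Or.inr hc
      obtain ⟨-, rfl, -⟩ := hmember v _ _ _ hk
      exact ⟨c, hk⟩
  · have hex : ∀ c, E.InCluster (t + 1) v c → (∃ c, E.InCluster t v c) → E.InCluster t v c := by
      rintro c h ⟨c0, h0⟩
      rcases member_know_succ ht h with h | h
      · exact h
      · exact absurd h0 ((joinFacts_cases (hr v) h).1 _ _ _)
    rcases member_know_succ ht h with h1 | h1
    · exact I.unique v c c' h1 (hex c' h' ⟨c, h1⟩)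
    · rcases member_know_succ ht h' with h2 | h2
      · exact I.unique v c c' (hex c h ⟨c', h2⟩) h2
      · have := joinFacts_unique h1 h2
        simpa using this
  · rcases (mem_peers_succ (hr u)).1 hx with hx | ⟨x', K, hx', hK⟩ | hx
    · obtain ⟨h1, h2, -⟩ := I.peer u x hx
      exact ⟨by omega, by omega, by omega⟩
    · rw [id_inj.1 hx'] at hK
      obtain ⟨h1, h2, -⟩ := I.peer x u (of_msg hK).1
      exact ⟨by omega, by omega, by omega⟩
    · obtain ⟨hux, c, q, hm, hq, -⟩ := (mem_pushTargets (hr u)).1 hx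
      rw [← know_succ_of_lt ht] at hm
      obtain ⟨-, rfl, hlt⟩ := hmember u _ _ _ hm
      have hle := tau_adj (mem_nbr.1 hux)
      exact ⟨hlt, hq ▸ sq_mono hle, fun h => (sq_injective (h.trans hq)).symm⟩
  · rcases member_know_succ ht hc with h | h
    · refine (I.parent v c h).imp (fun h => h) ?_
      rintro ⟨w, h1, h2, h3⟩
      exact ⟨w, h1, h2.mono (Nat.le_succ t), h3⟩
    · obtain ⟨hs, c', hf, h⟩ := I.join_value (hr v) h
      cases hf
      refine h.imp (fun h => h) ?_
      rintro ⟨w, h1, h2, h3, h4⟩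
      exact ⟨w, h1, h2.mono (Nat.le_succ t), hs ▸ h3, hs ▸ h4⟩

theorem phased {t : ℕ} (ht : t ≤ E.lo) : E.Phased t := by
  induction t with
  | zero => exact phased_zero
  | succ t ih => exact (ih (by omega)).succ (by omega)

end Execution

namespace Execution

variable {V : Type u} [Fintype V] {E : Execution V}

/-! ### Clusters -/

theorem exists_cluster (v : V) : ∃ c, E.InCluster E.lo v c :=
  ((phased le_rfl).joined v).2 <|
    (Nat.pow_lt_pow_left (Nat.lt_succ_self _) two_ne_zero).trans (tau_lt_lo v)

/-- The identifier of the centre of the cluster of a node. -/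
noncomputable def cl (E : Execution V) (v : V) : ℕ := (exists_cluster (E := E) v).choose

theorem inCluster_lo (v : V) : E.InCluster E.lo v (E.cl v) := (exists_cluster v).choose_spec

theorem InCluster.eq_cl {t : ℕ} (ht : t ≤ E.lo) {v : V} {c : ℕ} (h : E.InCluster t v c) :
    c = E.cl v :=
  (phased le_rfl).unique v _ _ (h.mono ht) (inCluster_lo v)

theorem inCluster_cl {t : ℕ} (ht : t ≤ E.lo) {v : V} (h : E.tau v ^ 2 < t) :
    E.InCluster t v (E.cl v) := by
  obtain ⟨c, hc⟩ := ((phased ht).joined v).2 h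
  rwa [← hc.eq_cl ht]

theorem exists_parent (v : V) : (E.cl v = E.id v ∧ E.tau v = E.start v) ∨
    ∃ w, E.tau w + 1 = E.tau v ∧ E.cl w = E.cl v ∧ E.id v ∈ E.peers (E.tau v ^ 2) w ∧
      E.id w ∈ E.peers (E.tau v ^ 2 + 1) v := by
  refine ((phased le_rfl).parent v _ (inCluster_lo v)).imp (fun h => h) ?_
  rintro ⟨w, h1, h2, h3⟩
  exact ⟨w, h1, (h2.eq_cl le_rfl).symm, h3⟩

theorem peers_symm_aux {t : ℕ} (ht : t ≤ E.lo) {u x : V} (h : E.id x ∈ E.peers t u) :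
    E.id u ∈ E.peers E.lo x := by
  induction t with
  | zero => simp [peers_zero] at h
  | succ t ih =>
    have hr := running_of_le_lo (E := E) (t := t) (by omega) u
    rcases (mem_peers_succ hr).1 h with h | ⟨x', K, hx', hK⟩ | hp
    · exact ih (by omega) h
    · rw [id_inj.1 hx'] at hK
      exact peers_mono (by omega) _ (of_msg hK).1
    · obtain ⟨-, c, q, hm, hq, -⟩ := (mem_pushTargets hr).1 hp
      rw [← know_succ_of_lt (by omega)] at hm
      obtain ⟨-, rfl⟩ := (phased ht).member u _ _ _ hm
      have := tau_lt_lo (E := E) u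
      exact peers_mono (by omega) _ (know_subset_of_peer (Nat.succ_pos t) (by omega) h).2

theorem peers_symm {u x : V} (h : E.id x ∈ E.peers E.lo u) : E.id u ∈ E.peers E.lo x :=
  peers_symm_aux le_rfl h

/-- The graph of the connections between peers after the first stage. -/
def spanner (E : Execution V) : SimpleGraph V where
  Adj u x := E.id x ∈ E.peers E.lo u
  symm := ⟨fun _ _ h => peers_symm h⟩
  loopless := ⟨fun u h => E.N.graph.loopless.irrefl u (adj_of_mem_peers h)⟩

/-- Following parents lowers the phase by one at each step and keeps the cluster, so the chain ends
at the node that opened it. Every tree edge forwards all knowledge in every round, in both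
directions, which gives the travel time `tau v - tau z`. -/
theorem exists_centre (v : V) : ∃ z, E.id z = E.cl v ∧ E.tau z = E.start z ∧ E.tau z ≤ E.tau v ∧
    E.start z + E.N.graph.dist z v ≤ E.tau v ∧
    (∃ p : E.spanner.Walk v z, p.length + E.tau z = E.tau v) ∧
    (∀ t, E.tau v ^ 2 < t → t + (E.tau v - E.tau z) ≤ E.lo →
      E.know t v ⊆ E.know (t + (E.tau v - E.tau z)) z ∧
      E.know t z ⊆ E.know (t + (E.tau v - E.tau z)) v) := by
  induction h : E.tau v generalizing v with
  | zero => exact absurd h (tau_pos v).ne'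
  | succ k ih =>
    rcases exists_parent v with ⟨h1, h2⟩ | ⟨w, h1, h2, h3, h4⟩
    · exact ⟨v, h1.symm, h2, h.le, by simp [← h2, h], ⟨.nil, by simpa using h⟩,
        fun t _ _ => by simp [h]⟩
    · have hk : E.tau w = k := by omega
      obtain ⟨z, z1, z2, z3, z4, ⟨p, hp⟩, z5⟩ := ih w hk
      have hlt := tau_lt_lo (E := E) v
      have hsq : E.tau v ^ 2 + 1 ≤ E.lo := by nlinarith
      have hvw : E.spanner.Adj v w := peers_mono hsq _ h4
      have hG : E.Adj w v := adj_of_mem_peers h3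
      refine ⟨z, z1.trans h2, z2, by omega, ?_, ⟨.cons hvw p, ?_⟩, fun t ht htl => ?_⟩
      · have := dist_le_dist_add_one (E := E) (u := z) hG
        omega
      · rw [SimpleGraph.Walk.length_cons]; omega
      · have hle : k ^ 2 ≤ (k + 1) ^ 2 := sq_mono (Nat.le_succ k)
        have e : k + 1 - E.tau z = k - E.tau z + 1 := by omega
        rw [h] at h3 h4
        constructor
        · have g1 := (know_subset_of_peer (by omega) (by omega)
            (peers_mono (Nat.succ_le_of_lt ht) _ h4)).1
          have g2 := (z5 (t + 1) (by omega) (by omega)).1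
          rw [e, show t + (k - E.tau z + 1) = t + 1 + (k - E.tau z) by ring]
          exact g1.trans g2
        · have g1 := (z5 t (by omega) (by omega)).2
          have g2 := (know_subset_of_peer (t := t + (k - E.tau z)) (by omega) (by omega)
            (peers_mono (by omega) _ h3)).1
          rw [e]
          exact g1.trans g2

/-- The centre of the cluster of a node. -/
noncomputable def centre (E : Execution V) (v : V) : V := (exists_centre (E := E) v).choose

theorem centre_eq_centre_iff {v w : V} : E.centre v = E.centre w ↔ E.cl v = E.cl w := by
  have hv : E.id (E.centre v) = E.cl v := (exists_centre v).choose_spec.1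
  have hw : E.id (E.centre w) = E.cl w := (exists_centre w).choose_spec.1
  rw [← hv, ← hw, id_inj]

theorem tau_centre_le (v : V) : E.tau (E.centre v) ≤ E.tau v :=
  (exists_centre v).choose_spec.2.2.1

theorem start_centre_le (v : V) :
    E.start (E.centre v) + E.N.graph.dist (E.centre v) v ≤ E.tau v :=
  (exists_centre v).choose_spec.2.2.2.1

theorem exists_walk_centre (v : V) :
    ∃ p : E.spanner.Walk v (E.centre v), p.length ≤ E.tau v := by
  obtain ⟨p, hp⟩ := (exists_centre (E := E) v).choose_spec.2.2.2.2.1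
  exact ⟨p, (Nat.le_add_right _ _).trans hp.le⟩

theorem know_centre (v : V) (t : ℕ) (h1 : E.tau v ^ 2 < t)
    (h2 : t + (E.tau v - E.tau (E.centre v)) ≤ E.lo) :
    E.know t v ⊆ E.know (t + (E.tau v - E.tau (E.centre v))) (E.centre v) ∧
      E.know t (E.centre v) ⊆ E.know (t + (E.tau v - E.tau (E.centre v))) v :=
  (exists_centre v).choose_spec.2.2.2.2.2 t h1 h2

/-- At the end of its phase, a node knows all members of its cluster. -/
theorem member_known {u w : V} (hc : E.cl w = E.cl u) (ht : E.tau w ≤ E.tau u) :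
    Item.member (E.id w) (E.nbr w) (E.cl u) (E.tau w) ∈ E.know ((E.tau u + 1) ^ 2) u := by
  have hz : E.centre w = E.centre u := centre_eq_centre_iff.2 hc
  have hlo := tau_lt_lo (E := E) u
  have hpos := tau_pos (E := E) (E.centre u)
  have h1 := tau_centre_le (E := E) u
  have h2 := tau_centre_le (E := E) w
  have hsq := sq_mono ht
  -- The `2 * tau u + 1` rounds of the phase pay for the way from `w` up to the centre and down to
  -- `u`, each of length at most `tau u`.
  have e : (E.tau u + 1) ^ 2 = E.tau u ^ 2 + 2 * E.tau u + 1 := by ring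
  have m0 : E.InCluster (E.tau u ^ 2 + 1) w (E.cl w) := inCluster_cl (by omega) (by omega)
  rw [hc] at m0
  have m1 := (know_centre w (E.tau u ^ 2 + 1) (by omega) (by omega)).1 m0
  rw [hz] at m1
  have m2 := (know_centre u (E.tau u ^ 2 + 1 + (E.tau w - E.tau (E.centre u))) (by omega)
    (by omega)).2 m1
  exact know_mono (by omega) _ m2

/-- The node `u` is the first of its cluster among the neighbours of `x`. -/
def First (E : Execution V) (u x : V) : Prop :=
  E.Adj u x ∧ ∀ w, E.cl w = E.cl u → E.Adj w x → E.tau w ≤ E.tau u →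
    E.tau u = E.tau w ∧ E.id u ≤ E.id w

theorem First.eq {u u' x : V} (h : E.First u x) (h' : E.First u' x) (hc : E.cl u = E.cl u') :
    u = u' := by
  have key : ∀ u u', E.First u x → E.First u' x → E.cl u = E.cl u' → E.tau u' ≤ E.tau u →
      u = u' := by
    intro u u' h h' hc ht
    have h1 := h.2 u' hc.symm h'.1 ht
    have h2 := h'.2 u hc h.1 h1.1.le
    exact id_inj.1 (le_antisymm h1.2 h2.2)
  rcases le_total (E.tau u') (E.tau u) with ht | ht
  · exact key u u' h h' hc ht
  · exact (key u' u h' h hc.symm ht).symm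

/-- Here completeness of knowledge enters. When `u` connects to `x`, it knows all members of its
cluster that joined no later (`member_known`), so passing the push test really makes it the first.
Peers acquired from an incoming message give the reversed case. -/
theorem first_or_first {t : ℕ} (ht : t ≤ E.lo) {u x : V} (h : E.id x ∈ E.peers t u) :
    E.First u x ∨ E.First x u := by
  induction t generalizing u x with
  | zero => simp [peers_zero] at h
  | succ t ih =>
    have hr := running_of_le_lo (E := E) (t := t) (by omega) u
    rcases (mem_peers_succ hr).1 h with h | ⟨x', K, hx', hK⟩ | h
    · exact ih (by omega) h
    · rw [id_inj.1 hx'] at hK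
      exact (ih (by omega) (of_msg hK).1).symm
    · left
      obtain ⟨hux, c, q, hm, hq, hmin⟩ := (mem_pushTargets hr).1 h
      rw [← know_succ_of_lt (by omega)] at hm hmin
      obtain ⟨-, rfl⟩ := (phased ht).member u _ _ _ hm
      obtain rfl : c = E.cl u := InCluster.eq_cl ht hm
      refine ⟨mem_nbr.1 hux, fun w hw hwx hle => ?_⟩
      have hk := member_known hw hle
      rw [← hq] at hk
      rcases (hmin _ _ _ hk).2 (mem_nbr.2 hwx) with h | h
      · omega
      · exact h

open Classical in
/-- The nodes from which a cluster may reach the neighbourhood of `x`. -/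
noncomputable def nearCentres (E : Execution V) (x : V) : Finset V :=
  Finset.univ.filter fun z => E.start z + E.N.graph.dist z x ≤ E.tau x + 2

-- Charge `u` to the centre of its cluster; this is injective because a cluster has only one first
-- neighbour of `x`. The slack of 2 consists of one for the edge from `u` to `x` and one from `tau u
-- ≤ tau x + 1`.
open Classical in
theorem card_first_le (x : V) :
    (Finset.univ.filter fun u => E.First u x).card ≤ (E.nearCentres x).card := by
  refine Finset.card_le_card_of_injOn E.centre (fun u hu => ?_) (fun u hu u' hu' h => ?_)
  · have hu : E.First u x := by simpa using hu
    have h1 := start_centre_le (E := E) u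
    have h2 := dist_le_dist_add_one (E := E) (u := E.centre u) hu.1
    have h3 := tau_adj hu.1.symm
    simp only [nearCentres, Finset.coe_filter, Finset.mem_univ, true_and, Set.mem_ofPred_eq]
    omega
  · have hu : E.First u x := by simpa using hu
    have hu' : E.First u' x := by simpa using hu'
    exact hu.eq hu' (centre_eq_centre_iff.1 h)

open Classical in
theorem card_spanner_le {R : ℕ} (hR : ∀ x, (E.nearCentres x).card ≤ R) :
    (Finset.univ.filter fun e : V × V => E.spanner.Adj e.1 e.2).card ≤
      2 * (Fintype.card V * R) := by
  have h1 : (Finset.univ.filter fun e : V × V => E.First e.1 e.2).card ≤ Fintype.card V * R := by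
    rw [Finset.card_filter, Fintype.sum_prod_type_right]
    calc _ ≤ ∑ _x : V, R := Finset.sum_le_sum fun x _ => by
            rw [← Finset.card_filter]; exact (card_first_le x).trans (hR x)
      _ = _ := by simp
  have h2 : (Finset.univ.filter fun e : V × V => E.First e.2 e.1).card ≤ Fintype.card V * R := by
    rw [Finset.card_filter, Fintype.sum_prod_type]
    calc _ ≤ ∑ _x : V, R := Finset.sum_le_sum fun x _ => by
            rw [← Finset.card_filter]; exact (card_first_le x).trans (hR x)
      _ = _ := by simp
  calc _ ≤ ((Finset.univ.filter fun e : V × V => E.First e.1 e.2) ∪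
        (Finset.univ.filter fun e : V × V => E.First e.2 e.1)).card := by
        refine Finset.card_le_card fun e he => ?_
        have he : E.spanner.Adj e.1 e.2 := by simpa using he
        simpa using first_or_first le_rfl he
    _ ≤ _ := (Finset.card_union_le _ _).trans (by omega)

/-! ### The spanner -/

theorem exists_walk_of_cl_eq {v w : V} (h : E.cl v = E.cl w) {K : ℕ}
    (hK : ∀ v, E.start v ≤ K) : ∃ p : E.spanner.Walk v w, p.length ≤ 2 * K := by
  obtain ⟨p, hp⟩ : ∃ p : E.spanner.Walk v (E.centre w), p.length ≤ E.tau v :=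
    centre_eq_centre_iff.2 h ▸ exists_walk_centre v
  obtain ⟨q, hq⟩ := exists_walk_centre (E := E) w
  have h1 := (tau_le_start v).trans (hK v)
  have h2 := (tau_le_start w).trans (hK w)
  exact ⟨p.append q.reverse, by
    rw [SimpleGraph.Walk.length_append, SimpleGraph.Walk.length_reverse]; omega⟩

/-- Within a cluster the detour passes through the centre. Otherwise the cluster of `y` has a
connection from some `w` to `x`, established at the end of the phase of its earliest member adjacent
to `x`, and `y` reaches `w` inside the cluster. -/
theorem exists_walk_of_adj {y x : V} (h : E.Adj y x) {K : ℕ} (hK : ∀ v, E.start v ≤ K) :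
    ∃ p : E.spanner.Walk y x, p.length ≤ 2 * K + 1 := by
  by_cases hc : E.cl y = E.cl x
  · obtain ⟨p, hp⟩ := exists_walk_of_cl_eq hc hK
    exact ⟨p, by omega⟩
  classical
  obtain ⟨u, hu, hmin⟩ := Finset.exists_min_image (Finset.univ.filter fun u =>
    E.cl u = E.cl y ∧ E.Adj u x) E.tau ⟨y, by simp [h]⟩
  simp only [Finset.mem_filter, Finset.mem_univ, true_and] at hu hmin
  have hlo := tau_lt_lo (E := E) u
  obtain ⟨w, hwc, -, hp⟩ := (phased hlo.le).exists_push hlo.le (c := E.cl y)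
    (by rw [← hu.1]; exact inCluster_cl hlo.le
          (Nat.pow_lt_pow_left (Nat.lt_succ_self _) two_ne_zero)) rfl hu.2
    (fun hx => hc (hx.eq_cl hlo.le)) (fun u' hu' ha => hmin u' ⟨(hu'.eq_cl hlo.le).symm, ha⟩)
  have hwx : E.spanner.Adj w x := peers_mono hlo.le _ hp
  obtain ⟨p, hp⟩ := exists_walk_of_cl_eq (v := y) (w := w) (hwc.eq_cl hlo.le) hK
  exact ⟨p.append (.cons hwx .nil), by simp [SimpleGraph.Walk.length_append]; omega⟩

theorem exists_walk_spanner (v w : V) {K : ℕ} (hK : ∀ v, E.start v ≤ K) :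
    ∃ p : E.spanner.Walk v w, p.length ≤ (2 * K + 1) * E.N.graph.dist v w := by
  obtain ⟨q, hq⟩ := (E.connected v w).exists_walk_length_eq_dist
  rw [← hq]
  clear hq
  induction q with
  | nil => exact ⟨.nil, by simp⟩
  | cons h q ih =>
    obtain ⟨p1, hp1⟩ := exists_walk_of_adj h hK
    obtain ⟨p2, hp2⟩ := ih
    refine ⟨p1.append p2, ?_⟩
    rw [SimpleGraph.Walk.length_append, SimpleGraph.Walk.length_cons]
    linarith

/-! ### The end of the first stage -/

theorem running_or_know_eq (t : ℕ) (v : V) : E.Running t v ∨ E.know (t + 1) v = E.know t v ∧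
    E.peers (t + 1) v = E.peers t v := by
  refine or_iff_not_imp_left.2 fun h => ?_
  unfold know peers
  rw [st_succ_of_halted h]
  exact ⟨rfl, rfl⟩

theorem clu_eq_rcv {t : ℕ} (ht : E.lo ≤ t) {v : V} (hr : E.Running t v) :
    E.clu t v = E.rcv t v := by
  refine Set.Subset.antisymm ?_ (rcv_subset_clu t v)
  rintro f (hf | hf)
  · exact hf
  · exact absurd ((inCluster_lo v).mono ht) ((joinFacts_cases hr hf).1 _ _ _)

theorem own_member_of_lo_le {t : ℕ} (ht : E.lo ≤ t) {v : V} {nb : Finset ℕ} {c q : ℕ}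
    (h : Item.member (E.id v) nb c q ∈ E.know t v) :
    Item.member (E.id v) nb c q ∈ E.know E.lo v := by
  induction t, ht using Nat.le_induction with
  | base => exact h
  | succ t ht ih =>
    rcases running_or_know_eq t v with hr | he
    · rw [know_succ hr] at h
      rcases h with h | ⟨-, x, hx, -⟩ | ⟨-, x, hx, -⟩
      · rw [clu_eq_rcv ht hr] at h
        exact ih (own_of_mem_rcv h rfl)
      · cases hx
      · cases hx
    · exact ih (he.1 ▸ h)

/-- After the first stage, the peers do not change any more. -/
theorem peers_eq {t : ℕ} (ht : E.lo ≤ t) (v : V) : E.peers t v = E.peers E.lo v := by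
  induction t, ht using Nat.le_induction generalizing v with
  | base => rfl
  | succ t ht ih =>
    rcases running_or_know_eq t v with hr | he
    · refine Set.Subset.antisymm (fun i hi => ?_) (peers_mono (by omega) v)
      rcases (mem_peers_succ hr).1 hi with hi | ⟨u, K, rfl, hK⟩ | hi
      · rwa [ih] at hi
      · have := (of_msg hK).1
        rw [ih] at this
        exact peers_symm this
      · obtain ⟨-, c, q, hm, hq, -⟩ := (mem_pushTargets hr).1 hi
        rw [clu_eq_rcv ht hr] at hm
        have hm := own_member_of_lo_le ht (own_of_mem_rcv hm rfl)
        obtain ⟨-, rfl⟩ := (phased le_rfl).member v _ _ _ hm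
        have := tau_lt_lo (E := E) v
        omega
    · rw [he.2, ih]

theorem mem_peers_iff {t : ℕ} (ht : E.lo ≤ t) {v : V} {i : ℕ} :
    i ∈ E.peers t v ↔ ∃ w, E.spanner.Adj v w ∧ E.id w = i := by
  rw [peers_eq ht]
  constructor
  · intro h
    obtain ⟨w, -, rfl⟩ := exists_of_mem_peers h
    exact ⟨w, h, rfl⟩
  · rintro ⟨w, h, rfl⟩
    exact h

end Execution

namespace Execution

variable {V : Type u} [Fintype V] {E : Execution V}

/-! ### Waves and echos -/

theorem lo_le_wk (v : V) : E.lo ≤ E.wk v := E.lo_le v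
theorem wk_le_hi (v : V) : E.wk v ≤ E.hi := E.le_hi v

theorem adoptFacts_subset {t : ℕ} {v : V} (hr : E.Running t v) (ha : E.wk v ≤ t) :
    E.ado t v ⊆ E.know (t + 1) v := by
  rw [know_succ hr]
  rintro f (hf | hf)
  · exact Or.inl hf
  · exact Or.inr (Or.inl ⟨ha, hf⟩)

theorem mem_adoptFacts {t : ℕ} {v : V} (hr : E.Running t v) {f : Item} :
    f ∈ (E.st t v).adoptFacts (E.Cand v) (E.peers (t + 1) v) (E.clu t v) ↔
      ∃ x, f = Item.adopt (E.id v) x t ∧ (∀ r, Item.adopt (E.id v) x r ∉ E.clu t v) ∧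
        (x = E.id v ∧ E.Cand v ∨ ∃ i ∈ E.peers (t + 1) v, ∃ r, Item.adopt i x r ∈ E.clu t v) := by
  simp only [NodeState.adoptFacts, Set.mem_ofPred_eq, input_id, round_eq hr]

theorem mem_doneFacts {t : ℕ} {v : V} {f : Item} :
    f ∈ (E.st t v).doneFacts (E.peers (t + 1) v) (E.ado t v) ↔
      ∃ x, f = Item.done (E.id v) x ∧ ∃ r, Item.adopt (E.id v) x r ∈ E.ado t v ∧
        ∀ i ∈ E.peers (t + 1) v, ∃ r', Item.adopt i x r' ∈ E.ado t v ∧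
          (r < r' → Item.done i x ∈ E.ado t v) := by
  simp only [NodeState.doneFacts, Set.mem_ofPred_eq, input_id]

theorem mem_know_succ {t : ℕ} {v : V} (hr : E.Running t v) {f : Item} :
    f ∈ E.know (t + 1) v ↔ f ∈ E.clu t v ∨
      (E.wk v ≤ t ∧ f ∈ (E.st t v).adoptFacts (E.Cand v) (E.peers (t + 1) v) (E.clu t v)) ∨
      (E.wk v ≤ t ∧ f ∈ (E.st t v).doneFacts (E.peers (t + 1) v) (E.ado t v)) := by
  rw [know_succ hr]
  rfl

/-- Facts about waves, as opposed to facts about the network and its clusters. -/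
def _root_.Item.IsWave : Item → Prop
  | .adopt _ _ _ => True
  | .done _ _ => True
  | _ => False

theorem mem_rcv_of_mem_clu {t : ℕ} {v : V} (hr : E.Running t v) {f : Item} (hf : f.IsWave)
    (h : f ∈ E.clu t v) : f ∈ E.rcv t v := by
  rcases h with h | h
  · exact h
  · rcases (joinFacts_cases hr h).2 with ⟨_, _, _, _, _, _, _, rfl⟩ | ⟨-, rfl⟩ <;> exact hf.elim

/-- Since nobody has the fact before its owner, the owner creates it by its own action while awake.
It is new in that round, which is what triggers sending. -/
theorem wave_created {t : ℕ} {v : V} {f : Item} (hf : f.IsWave) (ho : f.owner = E.id v)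
    (h : f ∈ E.know t v) : ∃ t' < t, E.Running t' v ∧ E.wk v ≤ t' ∧ f ∈ E.know (t' + 1) v ∧
      f ∉ E.clu t' v := by
  induction t with
  | zero =>
    rw [know_zero, Set.mem_singleton_iff] at h
    rw [h] at hf
    exact hf.elim
  | succ t ih =>
    by_cases h' : f ∈ E.know t v
    · obtain ⟨t', h1, h2⟩ := ih h'
      exact ⟨t', by omega, h2⟩
    · rcases running_or_know_eq t v with hr | he
      · have hc : f ∉ E.clu t v := fun hc =>
          h' (own_of_mem_rcv (mem_rcv_of_mem_clu hr hf hc) ho)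
        refine ⟨t, Nat.lt_succ_self t, hr, ?_, h, hc⟩
        rcases (mem_know_succ hr).1 h with h | ⟨h, -⟩ | ⟨h, -⟩
        · exact absurd h hc
        · exact h
        · exact h
      · exact absurd (he.1 ▸ h) h'

theorem mem_peers_of_spanner {t : ℕ} (ht : E.lo ≤ t) {v w : V} (h : E.spanner.Adj v w) :
    E.id w ∈ E.peers t v := (mem_peers_iff ht).2 ⟨w, h, rfl⟩

/-- Facts about waves are told to the neighbours in the spanner. -/
theorem wave_shared {t : ℕ} {v w : V} {f : Item} (hf : f.IsWave) (ho : f.owner = E.id v)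
    (h : f ∈ E.know t v) (hvw : E.spanner.Adj v w) (hw : E.Running t w) :
    f ∈ E.know (t + 1) w := by
  obtain ⟨t', ht, hr, hwk, h1, h2⟩ := wave_created hf ho h
  have hrw : E.Running (t' + 1) w := running_of_le ht hw
  have := (know_subset_of_sends hr hrw
    (mem_peers_of_spanner (by have := lo_le_wk (E := E) v; omega) hvw)
    (Or.inr (Or.inr ⟨f, h1, h2⟩))).1 h1
  exact know_mono (by omega) w (clu_subset hrw (rcv_subset_clu _ _ this))

/-- An adoption records the round in which it happens, and except at the root it is caused by a
spanner neighbour that adopted strictly earlier. This makes the adoption round a rank for the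
inductions below. -/
theorem adopt_created {t : ℕ} {v : V} {x r : ℕ}
    (h : Item.adopt (E.id v) x r ∈ E.know t v) : r < t ∧ E.wk v ≤ r ∧ E.Running r v ∧
      Item.adopt (E.id v) x r ∈ E.know (r + 1) v ∧
      (∀ r', Item.adopt (E.id v) x r' ∉ E.clu r v) ∧ (x = E.id v ∧ E.Cand v ∨
        ∃ w, E.spanner.Adj v w ∧ ∃ r', Item.adopt (E.id w) x r' ∈ E.know r w) := by
  obtain ⟨t', ht, hr, hwk, h1, h2⟩ := wave_created (f := .adopt _ _ _) trivial rfl h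
  have hlo := lo_le_wk (E := E) v
  rcases (mem_know_succ hr).1 h1 with h3 | ⟨-, h3⟩ | ⟨-, h3⟩
  · exact absurd h3 h2
  · obtain ⟨x', hx, hn, hc⟩ := (mem_adoptFacts hr).1 h3
    cases hx
    refine ⟨ht, hwk, hr, h1, hn, hc.imp (fun h => h) ?_⟩
    rintro ⟨i, hi, r', hr'⟩
    obtain ⟨w, hw, rfl⟩ := (mem_peers_iff (by omega)).1 hi
    refine ⟨w, hw, r', ?_⟩
    obtain ⟨u, hu, hk⟩ := owner_rcv (mem_rcv_of_mem_clu (f := .adopt _ _ _) hr trivial hr')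
    rwa [id_inj.1 hu] at hk
  · obtain ⟨x', hx, -⟩ := mem_doneFacts.1 h3
    cases hx

theorem adopt_unique {t t' : ℕ} {v : V} {x r r' : ℕ}
    (h : Item.adopt (E.id v) x r ∈ E.know t v) (h' : Item.adopt (E.id v) x r' ∈ E.know t' v) :
    r = r' := by
  have key : ∀ {t t' r r' : ℕ}, Item.adopt (E.id v) x r ∈ E.know t v →
      Item.adopt (E.id v) x r' ∈ E.know t' v → ¬ r < r' := by
    intro t t' r r' h h' hlt
    refine (adopt_created h').2.2.2.2.1 r ?_
    exact rcv_subset_clu _ _ (know_subset_rcv _ _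
      (know_mono hlt v (adopt_created h).2.2.2.1))
  exact le_antisymm (not_lt.1 (key h' h)) (not_lt.1 (key h h'))

theorem adopt_cand {t : ℕ} {v : V} {x r : ℕ} (h : Item.adopt (E.id v) x r ∈ E.know t v) :
    ∃ z, E.id z = x ∧ E.Cand z := by
  induction r using Nat.strong_induction_on generalizing t v with
  | _ r ih =>
    rcases (adopt_created h).2.2.2.2.2 with ⟨rfl, hc⟩ | ⟨w, -, r', hr'⟩
    · exact ⟨v, rfl, hc⟩
    · exact ih r' (adopt_created hr').1 hr'

/-- Two rounds per edge are allowed, for transmission and reaction. The hypothesis `hT` is needed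
because halted nodes do not pass waves on. -/
theorem exists_adopt {T : ℕ} (hT : ∀ w, E.Running T w) {z : V} (hz : E.Cand z) {v : V}
    (p : E.spanner.Walk v z) (hp : E.hi + 2 * p.length ≤ T) :
    ∃ r, Item.adopt (E.id v) (E.id z) r ∈ E.know (E.hi + 2 * p.length + 1) v := by
  have step : ∀ {v : V} {t : ℕ}, E.hi ≤ t → t ≤ T →
      (E.id z = E.id v ∧ E.Cand v ∨ ∃ i ∈ E.peers (t + 1) v, ∃ r,
        Item.adopt i (E.id z) r ∈ E.clu t v) →
      ∃ r, Item.adopt (E.id v) (E.id z) r ∈ E.know (t + 1) v := by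
    intro v t ht htT h
    have hr := running_of_le htT (hT v)
    by_cases hex : ∃ r, Item.adopt (E.id v) (E.id z) r ∈ E.clu t v
    · obtain ⟨r, hr'⟩ := hex
      exact ⟨r, clu_subset hr hr'⟩
    · push Not at hex
      exact ⟨t, adoptFacts_subset hr ((wk_le_hi v).trans ht)
        (Or.inr ((mem_adoptFacts hr).2 ⟨_, rfl, hex, h⟩))⟩
  induction p with
  | nil => exact step le_rfl (by simpa using hp) (Or.inl ⟨rfl, hz⟩)
  | @cons v w z hvw p ih =>
    rw [SimpleGraph.Walk.length_cons] at hp ⊢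
    obtain ⟨r, hr⟩ := ih hz (by omega) step
    refine step (t := E.hi + 2 * (p.length + 1)) (by omega) hp (Or.inr ⟨E.id w, mem_peers_of_spanner ?_ hvw, r, ?_⟩)
    · have := (lo_le_wk (E := E) v).trans (wk_le_hi v)
      omega
    · refine rcv_subset_clu _ _ (know_subset_rcv _ _ ?_)
      exact wave_shared (t := E.hi + 2 * p.length + 1) trivial rfl hr hvw.symm
        (running_of_le (by omega) (hT v))

/-- A node waits only for neighbours that adopted later, so the last to adopt finish first: the
induction runs backwards in the adoption round. The case `i = 0` is void, since adoptions known in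
round `M` happened before `M`. -/
theorem exists_done {T M : ℕ} (hT : ∀ w, E.Running T w) (hM : E.hi ≤ M) {x : ℕ}
    (ha : ∀ v, ∃ r, Item.adopt (E.id v) x r ∈ E.know M v) (i : ℕ) (hi : M + 2 * i ≤ T) {v : V}
    {r : ℕ} (hr : Item.adopt (E.id v) x r ∈ E.know M v) (hMr : M ≤ r + i) :
    Item.done (E.id v) x ∈ E.know (M + 2 * i) v := by
  induction i generalizing v r with
  | zero => have := (adopt_created hr).1; omega
  | succ i ih =>
    have hwk := wk_le_hi (E := E) v
    have hlo := lo_le_wk (E := E) v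
    have hrun : E.Running (M + 2 * i + 1) v := running_of_le (by omega) (hT v)
    have hk : E.know (M + 2 * i + 1) v ⊆ E.ado (M + 2 * i + 1) v :=
      ((know_subset_rcv _ _).trans (rcv_subset_clu _ _)).trans Set.subset_union_left
    refine (mem_know_succ hrun).2 (Or.inr (Or.inr ⟨by omega, mem_doneFacts.2
      ⟨x, rfl, r, hk (know_mono (by omega) v hr), fun j hj => ?_⟩⟩))
    obtain ⟨w, hvw, rfl⟩ := (mem_peers_iff (by omega)).1 hj
    obtain ⟨r', hr'⟩ := ha w
    refine ⟨r', hk (know_mono (by omega) v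
      (wave_shared trivial rfl hr' hvw.symm (running_of_le (by omega) (hT v)))), fun hlt => ?_⟩
    exact hk (wave_shared trivial rfl (ih (by omega) hr' (by omega)) hvw.symm
      (running_of_le (by omega) (hT v)))

theorem own_node_mem (t : ℕ) (v : V) : Item.node (E.id v) (E.nbr v) ∈ E.know t v :=
  know_mono (Nat.zero_le t) v rfl

/-- Echos are only finished after the echos of all later neighbours. -/
def EchoClosed (E : Execution V) (K : Set Item) : Prop :=
  ∀ v x, Item.done (E.id v) x ∈ K → Item.node (E.id v) (E.nbr v) ∈ K ∧
    ∃ r, Item.adopt (E.id v) x r ∈ K ∧ ∀ w, E.spanner.Adj v w →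
      ∃ r', Item.adopt (E.id w) x r' ∈ K ∧ (r < r' → Item.done (E.id w) x ∈ K)

/-- A message carries the whole knowledge of its sender, so a received echo comes together with
everything that justified it. A node's own echo satisfies the condition when it is created. -/
theorem echoClosed (t : ℕ) (v : V) : E.EchoClosed (E.know t v) := by
  induction t generalizing v with
  | zero => intro w x h; simp [know_zero] at h
  | succ t ih =>
    rcases running_or_know_eq t v with hr | he
    · intro u x h
      have lift : ∀ S ⊆ E.know (t + 1) v, E.EchoClosed S → Item.done (E.id u) x ∈ S →
          Item.node (E.id u) (E.nbr u) ∈ E.know (t + 1) v ∧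
          ∃ r, Item.adopt (E.id u) x r ∈ E.know (t + 1) v ∧ ∀ w, E.spanner.Adj u w →
            ∃ r', Item.adopt (E.id w) x r' ∈ E.know (t + 1) v ∧
              (r < r' → Item.done (E.id w) x ∈ E.know (t + 1) v) := by
        intro S hS hE hd
        obtain ⟨h1, r, h2, h3⟩ := hE u x hd
        refine ⟨hS h1, r, hS h2, fun w hw => ?_⟩
        obtain ⟨r', h4, h5⟩ := h3 w hw
        exact ⟨r', hS h4, fun h => hS (h5 h)⟩
      rcases (mem_know_succ hr).1 h with h | ⟨-, h⟩ | ⟨hwk, h⟩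
      · rcases mem_rcv.1 (mem_rcv_of_mem_clu (f := .done _ _) hr trivial h) with h | ⟨w, K, hK, hd⟩
        · exact lift _ (know_subset_succ t v) (ih v) h
        · refine lift K (fun f hf => clu_subset hr (rcv_subset_clu _ _
            (mem_rcv.2 (Or.inr ⟨w, K, hK, hf⟩)))) ?_ hd
          rw [(of_msg hK).2]
          exact ih w
      · obtain ⟨_, hx, -⟩ := (mem_adoptFacts hr).1 h
        cases hx
      · obtain ⟨x', hx, r, h1, h2⟩ := mem_doneFacts.1 h
        obtain ⟨huv, rfl⟩ := Item.done.inj hx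
        obtain rfl := id_inj.1 huv
        have hs := adoptFacts_subset hr hwk
        refine ⟨own_node_mem _ _, r, hs h1, fun w hw => ?_⟩
        obtain ⟨r', h3, h4⟩ := h2 _ (mem_peers_of_spanner (by
          have := lo_le_wk (E := E) u; omega) hw)
        exact ⟨r', hs h3, fun h => hs (h4 h)⟩
    · rw [he.1]; exact ih v

/-- The node knows all nodes of the network. -/
def AllKnown (E : Execution V) (t : ℕ) (v : V) : Prop :=
  ∀ u, Item.node (E.id u) (E.nbr u) ∈ E.know t v

/-- Induction on the adoption round. Any `v` other than the root adopted after some neighbour `w`,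
and the finished echo of `w` contains that of the later neighbour `v` by `echoClosed`. Each finished
echo brings along the neighbour list of its node. -/
theorem allKnown_of_done {t M : ℕ} {z : V}
    (ha : ∀ v, ∃ r, Item.adopt (E.id v) (E.id z) r ∈ E.know M v)
    (hd : Item.done (E.id z) (E.id z) ∈ E.know t z) : E.AllKnown t z := by
  have key : ∀ r v, Item.adopt (E.id v) (E.id z) r ∈ E.know M v →
      Item.done (E.id v) (E.id z) ∈ E.know t z := by
    intro r
    induction r using Nat.strong_induction_on with
    | _ r ih =>
      intro v hv
      rcases (adopt_created hv).2.2.2.2.2 with ⟨h, -⟩ | ⟨w, hvw, r', hr'⟩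
      · rw [← id_inj.1 h]; exact hd
      · have hw := ih r' (adopt_created hr').1 w
          (know_mono (adopt_created hv).1.le w hr')
        obtain ⟨-, r1, h1, h2⟩ := echoClosed t z w _ hw
        obtain ⟨r2, h3, h4⟩ := h2 v hvw.symm
        have e1 : r1 = r' := adopt_unique (own_know h1 rfl le_rfl) hr'
        have e2 : r2 = r := adopt_unique (own_know h3 rfl le_rfl) hv
        exact h4 (by rw [e1, e2]; exact (adopt_created hr').1)
  intro u
  obtain ⟨r, hr⟩ := ha u
  exact (echoClosed t z u _ (key r u hr)).1

/-! ### Termination -/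

theorem own_node_eq {t : ℕ} {v : V} {nb : Finset ℕ} (h : Item.node (E.id v) nb ∈ E.know t v) :
    nb = E.nbr v := by
  induction t with
  | zero => simpa [know_zero] using h
  | succ t ih =>
    rcases running_or_know_eq t v with hr | he
    · rcases (mem_know_succ hr).1 h with (h | h) | ⟨-, h⟩ | ⟨-, h⟩
      · exact ih (own_of_mem_rcv h rfl)
      · rcases (joinFacts_cases hr h).2 with ⟨_, _, _, _, _, _, _, h⟩ | ⟨-, h⟩ <;> cases h
      · obtain ⟨_, hx, -⟩ := (mem_adoptFacts hr).1 h
        cases hx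
      · obtain ⟨_, hx, -⟩ := mem_doneFacts.1 h
        cases hx
    · exact ih (he.1 ▸ h)

theorem exists_of_node_mem {t : ℕ} {v : V} {i : ℕ} {nb : Finset ℕ}
    (h : Item.node i nb ∈ E.know t v) : ∃ u, E.id u = i ∧ nb = E.nbr u := by
  obtain ⟨u, hu, hf⟩ := owner_know h
  obtain rfl : E.id u = i := hu
  exact ⟨u, rfl, own_node_eq hf⟩

/-- Known neighbour lists are genuine, so a set of known nodes that contains `v` and is closed under
adjacency is everything, by connectivity. Thus completion is detected locally, without the exact
value of `n`. -/
theorem complete_iff {t : ℕ} {v : V} : Complete (E.know t v) ↔ E.AllKnown t v := by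
  constructor
  · intro h u
    obtain ⟨p⟩ := E.connected v u
    have key : ∀ {a b : V} (p : E.N.graph.Walk a b), Item.node (E.id a) (E.nbr a) ∈ E.know t v →
        Item.node (E.id b) (E.nbr b) ∈ E.know t v := by
      intro a b p
      induction p with
      | nil => exact fun h => h
      | @cons a b _ hab p ih =>
        intro ha
        obtain ⟨nb, hb⟩ := h _ _ ha _ (mem_nbr.2 hab)
        obtain ⟨w, hw, rfl⟩ := exists_of_node_mem hb
        rw [id_inj.1 hw] at hb
        exact ih hb
    exact key p (own_node_mem t v)
  · intro h i nb hi j hj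
    obtain ⟨u, rfl, rfl⟩ := exists_of_node_mem hi
    obtain ⟨w, -, rfl⟩ := exists_of_mem_nbr hj
    exact ⟨_, h w⟩

theorem AllKnown.mono {t t' : ℕ} (h : t ≤ t') {v : V} (hk : E.AllKnown t v) : E.AllKnown t' v :=
  fun u => know_mono h v (hk u)

theorem halted_of_allKnown {t : ℕ} {v : V} (hwk : E.wk v ≤ t) (hk : E.AllKnown (t + 1) v) :
    ¬ E.Running (t + 1) v := by
  intro h
  have hr := running_of_le (Nat.le_succ t) h
  unfold Running at h
  rw [out_succ hr, if_pos ⟨hwk, complete_iff.2 hk⟩] at h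
  cases h

/-- Halting is always due to complete knowledge, so all outputs agree, whichever wave made it
possible. -/
theorem exists_halting_round {t : ℕ} {v : V} (h : ¬ E.Running t v) :
    ∃ t' < t, E.Running t' v ∧ E.wk v ≤ t' ∧ E.AllKnown (t' + 1) v ∧
      (E.st t v).out = some (sInf (Set.range E.id)) := by
  induction t with
  | zero => exact absurd (running_zero v) h
  | succ t ih =>
    by_cases hr : E.Running t v
    · have h' := h
      unfold Running at h
      rw [out_succ hr] at h
      split_ifs at h with hc
      · have hk := complete_iff.1 hc.2
        refine ⟨t, Nat.lt_succ_self t, hr, hc.1, hk, ?_⟩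
        rw [out_succ hr, if_pos hc]
        congr 2
        ext i
        constructor
        · rintro ⟨nb, hi⟩
          obtain ⟨u, rfl, -⟩ := exists_of_node_mem hi
          exact ⟨u, rfl⟩
        · rintro ⟨u, rfl⟩
          exact ⟨_, hk u⟩
      · exact absurd rfl h
    · obtain ⟨t', h1, h2⟩ := ih hr
      rw [st_succ_of_halted hr]
      exact ⟨t', by omega, h2⟩

/-- The last act of a halting node is to send its complete knowledge, so halting spreads over a
spanner edge within two rounds. -/
theorem halted_of_walk {t : ℕ} (ht : E.hi ≤ t) {v w : V} (hv : ¬ E.Running t v)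
    (p : E.spanner.Walk w v) : ¬ E.Running (t + 2 * p.length) w := by
  induction p with
  | nil => exact hv
  | @cons w w' v h p ih =>
    rw [SimpleGraph.Walk.length_cons]
    intro hr
    obtain ⟨t', h1, h2, h3, h4, -⟩ := exists_halting_round (ih hv)
    have hlo := lo_le_wk (E := E) w'
    have hrw : E.Running (t' + 1) w := running_of_le (by omega) hr
    have hs := (know_subset_of_sends h2 hrw (mem_peers_of_spanner (by omega) h.symm)
      (Or.inr (Or.inl ⟨h3, complete_iff.2 h4⟩))).1
    have hk : E.AllKnown (t' + 2) w := fun u =>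
      clu_subset hrw (rcv_subset_clu _ _ (hs (h4 u)))
    refine halted_of_allKnown (t := t + 2 * p.length + 1) ?_ (hk.mono (by omega)) hr
    have := wk_le_hi (E := E) w
    omega

/-- If there is a candidate and the spanner has diameter at most `L`, a leader is elected. -/
theorem electsLeader {L : ℕ} (hL : ∀ v w, ∃ p : E.spanner.Walk v w, p.length ≤ L)
    (hc : ∃ z, E.Cand z) {R : ℝ} (hR : ((3 * E.hi + 8 * L + 4 : ℕ) : ℝ) ≤ R) :
    E.alg.ElectsLeaderWithin E.N E.ω R := by
  obtain ⟨z, hz⟩ := hc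
  set M := E.hi + 2 * L + 1 with hM
  -- If nobody had halted, the wave of `z` would cover the network by round `M` and its echo would
  -- be complete by `3 * M`, so `z` would halt. Which node halts first is irrelevant, as halting
  -- then spreads in `2 * L` further rounds.
  have hhalt : ∃ v, ¬ E.Running (3 * M + 1) v := by
    by_contra! hT
    have ha : ∀ v, ∃ r, Item.adopt (E.id v) (E.id z) r ∈ E.know M v := by
      intro v
      obtain ⟨p, hp⟩ := hL v z
      obtain ⟨r, hr⟩ := exists_adopt hT hz p (by omega)
      exact ⟨r, know_mono (by omega) v hr⟩
    obtain ⟨r, hr⟩ := ha z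
    have hd := exists_done hT (by omega) ha M (by omega) hr (by omega)
    refine halted_of_allKnown (t := 3 * M) ?_
      ((allKnown_of_done ha hd).mono (by omega)) (hT z)
    have := wk_le_hi (E := E) z
    omega
  obtain ⟨v0, hv0⟩ := hhalt
  have hall : ∀ w, ¬ E.Running (3 * E.hi + 8 * L + 4) w := by
    intro w hw
    obtain ⟨p, hp⟩ := hL w v0
    exact halted_of_walk (by omega) hv0 p (running_of_le (by omega) hw)
  refine ⟨_, hR, ?_⟩
  obtain ⟨l, hl⟩ := Nat.sInf_mem (s := Set.range E.id) ⟨_, z, rfl⟩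
  refine ⟨l, fun v => ?_⟩
  obtain ⟨-, -, -, -, -, h⟩ := exists_halting_round (hall v)
  exact h.trans (congrArg some hl.symm)

/-! ### The number of messages -/

open Classical in
/-- the set of candidates -/
noncomputable def cands (E : Execution V) : Finset V := Finset.univ.filter E.Cand

-- The sending rounds split into those before waking up, those with a new adoption (`A`), those with
-- a new echo (`D`) and the halting round (`H`). Adoption and echo occur at most once per candidate.
open Classical in
theorem card_sends_le (T : ℕ) (v : V) :
    ((Finset.range T).filter fun t => E.Running t v ∧ E.Sends t v).card ≤
      E.hi + 2 * E.cands.card + 1 := by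
  have : Nonempty V := ⟨v⟩
  set A := (Finset.range T).filter fun t => E.Running t v ∧ E.wk v ≤ t ∧
    ∃ z ∈ E.cands, Item.adopt (E.id v) (E.id z) t ∈ E.know (t + 1) v with hA
  set D := (Finset.range T).filter fun t => E.Running t v ∧ E.wk v ≤ t ∧
    ∃ z ∈ E.cands, Item.done (E.id v) (E.id z) ∈ E.know (t + 1) v ∧
      Item.done (E.id v) (E.id z) ∉ E.know t v with hD
  set H := (Finset.range T).filter fun t => E.Running t v ∧ ¬ E.Running (t + 1) v with hH
  have hAc : A.card ≤ E.cands.card := by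
    choose! f hf using fun t (ht : t ∈ A) => (Finset.mem_filter.1 ht).2.2.2
    refine Finset.card_le_card_of_injOn f (fun t ht => (hf t ht).1) fun t ht t' ht' h => ?_
    have h1 := (hf t ht).2
    have h2 := (hf t' ht').2
    rw [h] at h1
    exact adopt_unique h1 h2
  have hDc : D.card ≤ E.cands.card := by
    choose! f hf using fun t (ht : t ∈ D) => (Finset.mem_filter.1 ht).2.2.2
    refine Finset.card_le_card_of_injOn f (fun t ht => (hf t ht).1) fun t ht t' ht' h => ?_
    have h1 := (hf t ht).2
    have h2 := (hf t' ht').2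
    rw [h] at h1
    rcases lt_trichotomy t t' with hlt | heq | hlt
    · exact absurd (know_mono hlt v h1.1) h2.2
    · exact heq
    · exact absurd (know_mono hlt v h2.1) h1.2
  have hHc : H.card ≤ 1 := by
    refine Finset.card_le_one.2 fun t ht t' ht' => ?_
    have h1 := (Finset.mem_filter.1 ht).2
    have h2 := (Finset.mem_filter.1 ht').2
    by_contra hne
    rcases Nat.lt_or_gt_of_ne hne with hlt | hlt
    · exact h1.2 (running_of_le hlt h2.1)
    · exact h2.2 (running_of_le hlt h1.1)
  have hsub : ((Finset.range T).filter fun t => E.Running t v ∧ E.Sends t v) ⊆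
      Finset.range E.hi ∪ A ∪ D ∪ H := by
    intro t ht
    obtain ⟨htT, hr, hs⟩ := Finset.mem_filter.1 ht
    simp only [Finset.mem_union]
    rcases hs with hs | ⟨hwk, hs⟩ | ⟨f, hf, hfc⟩
    · exact Or.inl (Or.inl (Or.inl (Finset.mem_range.2 (hs.trans_le (wk_le_hi v)))))
    · exact Or.inr (Finset.mem_filter.2 ⟨htT, hr, halted_of_allKnown hwk (complete_iff.1 hs)⟩)
    · have hado : ∀ x r, Item.adopt (E.id v) x r ∈ E.know (t + 1) v →
          ∃ z ∈ E.cands, E.id z = x := by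
        intro x r h
        obtain ⟨z, hz, hc⟩ := adopt_cand h
        exact ⟨z, Finset.mem_filter.2 ⟨Finset.mem_univ z, hc⟩, hz⟩
      rcases (mem_know_succ hr).1 hf with h | ⟨hwk, h⟩ | ⟨hwk, h⟩
      · exact absurd h hfc
      · obtain ⟨x, rfl, -⟩ := (mem_adoptFacts hr).1 h
        obtain ⟨z, hz, rfl⟩ := hado _ _ hf
        exact Or.inl (Or.inl (Or.inr (Finset.mem_filter.2 ⟨htT, hr, hwk, z, hz, hf⟩)))
      · obtain ⟨x, rfl, r, hx, -⟩ := mem_doneFacts.1 h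
        obtain ⟨z, hz, rfl⟩ := hado _ _ (adoptFacts_subset hr hwk hx)
        exact Or.inl (Or.inr (Finset.mem_filter.2 ⟨htT, hr, hwk, z, hz, hf, fun h =>
          hfc (rcv_subset_clu _ _ (know_subset_rcv _ _ h))⟩))
  refine (Finset.card_le_card hsub).trans ?_
  refine (Finset.card_union_le _ _).trans ?_
  refine (Nat.add_le_add_right (Finset.card_union_le _ _) _).trans ?_
  refine (Nat.add_le_add_right (Nat.add_le_add_right (Finset.card_union_le _ _) _) _).trans ?_
  rw [Finset.card_range]
  omega

theorem peers_subset_spanner {t : ℕ} {v w : V} (h : E.id w ∈ E.peers t v) :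
    E.spanner.Adj v w := by
  rcases le_total t E.lo with ht | ht
  · exact peers_mono ht v h
  · rwa [peers_eq ht] at h

open Classical in
theorem messagesAtMost {R : ℕ} (hR : ∀ x, (E.nearCentres x).card ≤ R) {B : ℝ}
    (hB : ((2 * (Fintype.card V * R) * (E.hi + 2 * E.cands.card + 1) : ℕ) : ℝ) ≤ B) :
    E.alg.MessagesAtMost E.N E.ω B := by
  intro T
  refine le_trans (Nat.cast_le.2 ?_) hB
  have h1 : ∀ t, E.alg.messagesInRound E.N E.ω t ≤ ∑ e ∈ Finset.univ.filter (fun e : V × V =>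
      E.spanner.Adj e.1 e.2), if E.Running t e.1 ∧ E.Sends t e.1 then 1 else 0 := by
    intro t
    rw [← Finset.card_filter, Finset.filter_filter]
    refine Finset.card_le_card fun e he => ?_
    simp only [Finset.mem_filter, Finset.mem_univ, true_and] at he ⊢
    obtain ⟨K, hK⟩ := Option.isSome_iff_exists.1 he
    obtain ⟨h1, h2, h3, -⟩ := of_msg_succ (E := E) hK
    exact ⟨peers_subset_spanner h2, h1, h3⟩
  calc ∑ t ∈ Finset.range T, E.alg.messagesInRound E.N E.ω t
      ≤ ∑ t ∈ Finset.range T, ∑ e ∈ Finset.univ.filter (fun e : V × V =>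
        E.spanner.Adj e.1 e.2), if E.Running t e.1 ∧ E.Sends t e.1 then 1 else 0 :=
        Finset.sum_le_sum fun t _ => h1 t
    _ = ∑ e ∈ Finset.univ.filter (fun e : V × V => E.spanner.Adj e.1 e.2),
        ((Finset.range T).filter fun t => E.Running t e.1 ∧ E.Sends t e.1).card := by
        rw [Finset.sum_comm]
        exact Finset.sum_congr rfl fun e _ => (Finset.card_filter _ _).symm
    _ ≤ ∑ _e ∈ Finset.univ.filter (fun e : V × V => E.spanner.Adj e.1 e.2),
        (E.hi + 2 * E.cands.card + 1) := Finset.sum_le_sum fun e _ => card_sends_le T e.1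
    _ ≤ _ := by
        rw [Finset.sum_const, smul_eq_mul]
        exact Nat.mul_le_mul_right _ (card_spanner_le hR)

end Execution

/-! ### Coin tosses -/

/-- The indicator of the event that the first `j` coins of the round `0` show heads. -/
def headInd (j : ℕ) (x : ℕ × ℕ → Bool) : ℝ := if ∀ i < j, x (0, i) = true then 1 else 0

/-- The coins of a single node. -/
noncomputable def nodeMeasure : Measure (ℕ × ℕ → Bool) :=
  Measure.infinitePi fun _ => (PMF.uniformOfFintype Bool).toMeasure

instance : IsProbabilityMeasure nodeMeasure := by unfold nodeMeasure; infer_instance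

instance (V : Type u) : IsProbabilityMeasure (coinMeasure V) := by
  unfold coinMeasure; infer_instance

theorem headInd_eq_indicator (j : ℕ) : headInd j =
    (Set.pi (((Finset.range j).image (Prod.mk 0) : Finset (ℕ × ℕ)) : Set (ℕ × ℕ))
      fun _ => ({true} : Set Bool)).indicator fun _ => (1 : ℝ) := by
  classical
  ext x
  unfold headInd Set.indicator
  congr 1
  simp [Set.mem_pi]

theorem measurableSet_heads (j : ℕ) : MeasurableSet
    (Set.pi (((Finset.range j).image (Prod.mk 0) : Finset (ℕ × ℕ)) : Set (ℕ × ℕ)) fun _ => ({true} : Set Bool)) :=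
  MeasurableSet.pi (Finset.countable_toSet _) fun _ _ => MeasurableSet.singleton _

theorem integrable_headInd (j : ℕ) : Integrable (headInd j) nodeMeasure := by
  rw [headInd_eq_indicator]
  exact (integrable_const 1).indicator (measurableSet_heads j)

theorem integral_headInd (j : ℕ) : ∫ x, headInd j x ∂nodeMeasure = 1 / 2 ^ j := by
  rw [headInd_eq_indicator, integral_indicator_const _ (measurableSet_heads j), nodeMeasure,
    measureReal_def, Measure.infinitePi_pi _ fun _ _ => MeasurableSet.singleton _]
  rw [Finset.prod_const, Finset.card_image_of_injective _ (Prod.mk_right_injective 0)]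
  rw [PMF.toMeasure_apply_singleton _ _ (MeasurableSet.singleton _)]
  simp

/-- Markov's inequality for products of functions of the coins of single nodes. -/
theorem coinMeasure_le_of_prod {V : Type u} [Fintype V] (p q r : V → ℝ) (j j' : V → ℕ)
    (h0 : ∀ v x, 0 ≤ p v + q v * headInd (j v) x + r v * headInd (j' v) x) {lam : ℝ}
    (hlam : 0 < lam) (S : Set (CoinTosses V))
    (hS : ∀ ω ∈ S, lam ≤ ∏ v, (p v + q v * headInd (j v) (fun i => ω (v, i)) +
      r v * headInd (j' v) (fun i => ω (v, i)))) :
    (coinMeasure V).real S ≤ (∏ v, (p v + q v * (1 / 2 ^ j v) + r v * (1 / 2 ^ j' v))) / lam := by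
  set f : V → (ℕ × ℕ → Bool) → ℝ := fun v x =>
    p v + q v * headInd (j v) x + r v * headInd (j' v) x with hf
  have hfi : ∀ v, Integrable (f v) nodeMeasure := fun v =>
    ((integrable_const _).add ((integrable_headInd _).const_mul _)).add
      ((integrable_headInd _).const_mul _)
  have hfe : ∀ v, ∫ x, f v x ∂nodeMeasure = p v + q v * (1 / 2 ^ j v) + r v * (1 / 2 ^ j' v) := by
    intro v
    rw [hf]
    simp only
    rw [integral_add, integral_add, integral_const_mul, integral_const_mul, integral_headInd,
      integral_headInd]
    · simp
    · exact integrable_const _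
    · exact (integrable_headInd _).const_mul _
    · exact (integrable_const _).add ((integrable_headInd _).const_mul _)
    · exact (integrable_headInd _).const_mul _
  -- Grouping the coins by nodes gives a product of identical measures, so the expectation of the
  -- product factorises.
  have hmap : (coinMeasure V).map (MeasurableEquiv.curry V (ℕ × ℕ) Bool) =
      Measure.pi fun _ : V => nodeMeasure := by
    rw [← Measure.infinitePi_eq_pi]
    exact Measure.infinitePi_map_curry fun _ _ => (PMF.uniformOfFintype Bool).toMeasure
  have hmp : MeasurePreserving (MeasurableEquiv.curry V (ℕ × ℕ) Bool) (coinMeasure V)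
      (Measure.pi fun _ : V => nodeMeasure) := ⟨MeasurableEquiv.measurable _, hmap⟩
  have hint : Integrable (fun x : V → ℕ × ℕ → Bool => ∏ v, f v (x v))
      (Measure.pi fun _ : V => nodeMeasure) := Integrable.fintype_prod_dep hfi
  have hint' := (hmp.integrable_comp hint.aestronglyMeasurable).2 hint
  have hmk := mul_meas_ge_le_integral_of_nonneg
    (Filter.Eventually.of_forall fun ω => Finset.prod_nonneg fun v _ => h0 v _) hint' lam
  have hI := hmp.integral_comp' (g := fun x : V → ℕ × ℕ → Bool => ∏ v, f v (x v))
  rw [integral_fintype_prod_eq_prod] at hI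
  simp only [hfe] at hI
  rw [le_div_iff₀ hlam, mul_comm, ← hI]
  refine le_trans (mul_le_mul_of_nonneg_left ?_ hlam.le) hmk
  exact measureReal_mono fun ω hω => hS ω hω

/-! ### Tail bounds for leading heads -/

section Events

variable {V : Type u}

/-- The first `j` coins of the node `v` show heads. -/
def Heads (ω : CoinTosses V) (v : V) (j : ℕ) : Prop := ∀ i < j, ω (v, 0, i) = true

theorem Heads.mono {ω : CoinTosses V} {v : V} {j j' : ℕ} (h : Heads ω v j') (hj : j ≤ j') :
    Heads ω v j := fun i hi => h i (hi.trans_le hj)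

open Classical in
theorem headInd_eq (ω : CoinTosses V) (v : V) (j : ℕ) :
    headInd j (fun i => ω (v, i)) = if Heads ω v j then 1 else 0 := by
  unfold headInd Heads
  congr

theorem headInd_nonneg (j : ℕ) (x : ℕ × ℕ → Bool) : 0 ≤ headInd j x := by
  unfold headInd; split_ifs <;> norm_num

theorem headInd_le_one (j : ℕ) (x : ℕ × ℕ → Bool) : headInd j x ≤ 1 := by
  unfold headInd; split_ifs <;> norm_num

theorem headInd_anti {j j' : ℕ} (h : j ≤ j') (x : ℕ × ℕ → Bool) : headInd j' x ≤ headInd j x := by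
  unfold headInd
  split_ifs with h1 h2
  · exact le_rfl
  · exact absurd (fun i hi => h1 i (hi.trans_le h)) h2
  · norm_num
  · exact le_rfl

variable [Fintype V]

theorem measure_heads_le (v : V) (j : ℕ) :
    (coinMeasure V).real {ω | Heads ω v j} ≤ 1 / 2 ^ j := by
  classical
  have := coinMeasure_le_of_prod (V := V) (fun w => if w = v then 0 else 1)
    (fun w => if w = v then 1 else 0) (fun _ => 0) (fun _ => j) (fun _ => 0)
    (fun w x => by have := headInd_nonneg j x; split_ifs <;> simp [this]) one_pos
    {ω | Heads ω v j} (fun ω hω => le_of_eq ?_)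
  · refine this.trans (le_of_eq ?_)
    rw [div_one, Finset.prod_eq_single v]
    · simp
    · intro w _ hw; simp [hw]
    · intro h; exact absurd (Finset.mem_univ v) h
  · symm
    refine Finset.prod_eq_one fun w _ => ?_
    by_cases hw : w = v
    · subst hw
      have hω : Heads ω w j := hω
      simp [headInd_eq, hω]
    · simp [hw]

/-- The product of the indicators of the complementary events equals 1 on the event, so the Markov
bound is applied with threshold 1. -/
theorem measure_no_heads_le (b : V → ℕ) :
    (coinMeasure V).real {ω | ∀ v, ¬ Heads ω v (b v)} ≤ ∏ v, (1 - 1 / 2 ^ b v) := by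
  have := coinMeasure_le_of_prod (V := V) (fun _ => 1) (fun _ => -1) (fun _ => 0) b (fun _ => 0)
    (fun w x => by have := headInd_le_one (b w) x; simp [this]) one_pos
    {ω | ∀ v, ¬ Heads ω v (b v)} (fun ω hω => le_of_eq ?_)
  · refine this.trans (le_of_eq ?_)
    rw [div_one]
    exact Finset.prod_congr rfl fun v _ => by ring
  · symm
    refine Finset.prod_eq_one fun w _ => ?_
    have hω : ¬ Heads ω w (b w) := hω w
    simp [headInd_eq, hω]

-- Markov's inequality for 2 to the power of the number of successful nodes.
open Classical in
theorem measure_many_heads_le (b : V → ℕ) (R : ℕ) :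
    (coinMeasure V).real {ω | R ≤ (Finset.univ.filter fun v => Heads ω v (b v)).card} ≤
      (∏ v, (1 + 1 / 2 ^ b v)) / 2 ^ R := by
  have := coinMeasure_le_of_prod (V := V) (fun _ => 1) (fun _ => 1) (fun _ => 0) b (fun _ => 0)
    (fun w x => by have := headInd_nonneg (b w) x; linarith) (lam := 2 ^ R) (by positivity)
    {ω | R ≤ (Finset.univ.filter fun v => Heads ω v (b v)).card} (fun ω hω => ?_)
  · refine this.trans (le_of_eq ?_)
    congr 1
    exact Finset.prod_congr rfl fun v _ => by ring
  · have : ∀ v, (1 : ℝ) + 1 * headInd (b v) (fun i => ω (v, i)) +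
        0 * headInd 0 (fun i => ω (v, i)) = if Heads ω v (b v) then 2 else 1 := by
      intro v
      rw [headInd_eq]
      split_ifs <;> norm_num
    rw [Finset.prod_congr rfl fun v _ => this v]
    rw [Finset.prod_ite, Finset.prod_const, Finset.prod_const, one_pow, mul_one]
    exact pow_le_pow_right₀ one_le_two hω

open Classical in
/-- If many nodes show a number of heads, then one of them shows three more. -/
theorem measure_gap_le (a : V → ℕ) (R : ℕ) :
    (coinMeasure V).real {ω | R ≤ (Finset.univ.filter fun v => Heads ω v (a v)).card ∧
      ∀ v, ¬ Heads ω v (a v + 3)} ≤ (7 / 8) ^ R := by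
  -- Three more heads have conditional probability `1/8`, so the weights `1/7` and `-(8/7)` give
  -- each factor expectation 1. A factor vanishes if the three heads appear, and otherwise equals
  -- `8/7` at every node counted in the event.
  have := coinMeasure_le_of_prod (V := V) (fun _ => 1) (fun _ => 1 / 7) (fun _ => - (8 / 7)) a
    (fun v => a v + 3) (fun w x => ?_) (lam := (8 / 7) ^ R) (by positivity)
    {ω | R ≤ (Finset.univ.filter fun v => Heads ω v (a v)).card ∧
      ∀ v, ¬ Heads ω v (a v + 3)} (fun ω hω => ?_)
  · refine this.trans (le_of_eq ?_)
    rw [Finset.prod_eq_one, one_div, ← inv_pow]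
    · norm_num
    · intro v _
      rw [pow_add]
      field_simp
      ring
  · have h1 := headInd_anti (Nat.le_add_right (a w) 3) x
    have h2 := headInd_le_one (a w + 3) x
    linarith
  · have : ∀ v, (1 : ℝ) + 1 / 7 * headInd (a v) (fun i => ω (v, i)) +
        - (8 / 7) * headInd (a v + 3) (fun i => ω (v, i)) =
        if Heads ω v (a v) then 8 / 7 else 1 := by
      intro v
      rw [headInd_eq, headInd_eq, if_neg (hω.2 v)]
      split_ifs <;> norm_num
    rw [Finset.prod_congr rfl fun v _ => this v]
    rw [Finset.prod_ite, Finset.prod_const, Finset.prod_const, one_pow, mul_one]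
    exact pow_le_pow_right₀ (by norm_num) hω.1

end Events

/-! ### Good coin tosses -/

section Good

variable {V : Type u} {N : Network V} {kk wake thr : ℕ → ℕ} {ω : CoinTosses V}

theorem le_nodeHeads_iff_heads {v : V} {j : ℕ} (hj : j ≤ kk (N.estimate v)) :
    j ≤ nodeHeads kk N ω v ↔ Heads ω v j := le_nodeHeads_iff hj

variable [Fintype V]

open Classical in
/-- The properties of the coins that make the algorithm succeed: no node has heads only, there are
candidates, but fewer than `R'`, and no node is near to `R` cluster centres. -/
structure GoodCoins (N : Network V) (kk thr : ℕ → ℕ) (K R R' : ℕ) (ω : CoinTosses V) : Prop where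
  not_all : ∀ v, ¬ Heads ω v (kk (N.estimate v))
  cand : ∃ v, Heads ω v (thr (N.estimate v))
  few : ¬ R' ≤ (Finset.univ.filter fun v => Heads ω v (thr (N.estimate v))).card
  near : ∀ x, ∀ τ ∈ Finset.range (K + 1),
    ¬ (R ≤ (Finset.univ.filter fun z =>
        Heads ω z (kk (N.estimate z) + N.graph.dist z x - (τ + 2))).card ∧
      ∀ z, ¬ Heads ω z (kk (N.estimate z) + N.graph.dist z x - (τ + 2) + 3))

theorem GoodCoins.succeeds {K R R' lo hi : ℕ} (h : GoodCoins N kk thr K R R' ω)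
    (hconn : N.graph.Connected) (hinj : Function.Injective N.id)
    (hlo : ∀ v, lo ≤ wake (N.estimate v)) (hhi : ∀ v, wake (N.estimate v) ≤ hi)
    (hkk : ∀ v, (kk (N.estimate v) + 1) ^ 2 < lo) (hK : ∀ v, kk (N.estimate v) ≤ K)
    (hthr : ∀ v, thr (N.estimate v) ≤ kk (N.estimate v)) {T B : ℝ}
    (hT : ((3 * hi + 8 * ((2 * K + 1) * N.graph.diam) + 4 : ℕ) : ℝ) ≤ T)
    (hB : ((2 * (Fintype.card V * R) * (hi + 2 * R' + 1) : ℕ) : ℝ) ≤ B) :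
    (electionAlgorithm kk wake thr).ElectsLeaderWithin N ω T ∧
      (electionAlgorithm kk wake thr).MessagesAtMost N ω B := by
  classical
  have hlt : ∀ v, nodeHeads kk N ω v < kk (N.estimate v) := fun v => by
    by_contra hle
    exact h.not_all v ((le_nodeHeads_iff_heads le_rfl).1 (not_lt.1 hle))
  let E : Execution V :=
    { N := N, ω := ω, kk := kk, wake := wake, thr := thr, connected := hconn, injective := hinj
      lo := lo, hi := hi, lo_le := hlo, le_hi := hhi
      start_pos := fun v => Nat.sub_pos_of_lt (hlt v)
      start_lt := fun v => (Nat.pow_le_pow_left (by omega) 2).trans_lt (hkk v) }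
  have hstart : ∀ v, E.start v = kk (N.estimate v) - nodeHeads kk N ω v := fun _ => rfl
  have hSK : ∀ v, E.start v ≤ K := fun v => by
    rw [hstart]
    exact (Nat.sub_le _ _).trans (hK v)
  have hcand : ∀ v, E.Cand v ↔ Heads ω v (thr (N.estimate v)) := fun v =>
    le_nodeHeads_iff_heads (hthr v)
  have : Nonempty V := hconn.nonempty
  constructor
  · refine Execution.electsLeader (E := E) (fun v w => ?_) ?_ hT
    · obtain ⟨p, hp⟩ := Execution.exists_walk_spanner v w hSK
      refine ⟨p, hp.trans (Nat.mul_le_mul_left _ ?_)⟩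
      exact SimpleGraph.dist_le_diam (SimpleGraph.connected_iff_ediam_ne_top.1 hconn)
    · obtain ⟨v, hv⟩ := h.cand
      exact ⟨v, (hcand v).2 hv⟩
  · refine Execution.messagesAtMost (E := E) (R := R) (fun x => ?_) ((Nat.cast_le.2 ?_).trans hB)
    -- For the value `tau x` of `τ`, three further heads at `z` would give `start z + dist z x < tau
    -- x`, against minimality. The truncation of the count does no harm, as no node has heads only.
    -- So the second half of the gap event holds automatically and the first must fail. All `τ` are
    -- covered because `tau x` is random.
    · have hnear := h.near x (E.tau x)
        (Finset.mem_range.2 (Nat.lt_succ_of_le ((Execution.tau_le_start x).trans (hSK x))))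
      by_contra hR
      refine hnear ⟨(not_le.1 hR).le.trans (Finset.card_le_card fun z hz => ?_), fun z hz => ?_⟩
      · have hz : E.start z + N.graph.dist z x ≤ E.tau x + 2 := (Finset.mem_filter.1 hz).2
        refine Finset.mem_filter.2 ⟨Finset.mem_univ z, ?_⟩
        have := hlt z
        have hs := hstart z
        exact (le_nodeHeads_iff_heads (N := N) (kk := kk) (by omega)).1 (by omega)
      · have h1 : kk (N.estimate z) + N.graph.dist z x - (E.tau x + 2) + 3 ≤
            kk (N.estimate z) := by
          by_contra hn
          exact h.not_all z (hz.mono (by omega))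
        have h2 := (le_nodeHeads_iff_heads (N := N) h1).2 hz
        have h3 : E.tau x ≤ E.start z + N.graph.dist z x := Execution.tau_le z x
        have := hlt z
        have hs := hstart z
        omega
    · refine Nat.mul_le_mul_left _ ?_
      have : E.cands.card < R' := by
        refine lt_of_eq_of_lt (congrArg _ ?_) (not_le.1 h.few)
        exact Finset.filter_congr fun v _ => hcand v
      show hi + 2 * E.cands.card + 1 ≤ _
      omega

/-- The union bound for bad coins. -/
theorem one_sub_le_measure_good {K R R' : ℕ} {ε : ℝ}
    (h1 : ∀ v, 1 / 2 ^ kk (N.estimate v) ≤ ε / (Fintype.card V))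
    (h2 : ∏ v, (1 - 1 / 2 ^ thr (N.estimate v) : ℝ) ≤ ε)
    (h3 : (∏ v, (1 + 1 / 2 ^ thr (N.estimate v) : ℝ)) / 2 ^ R' ≤ ε)
    (h4 : Fintype.card V * (K + 1) * (7 / 8) ^ R ≤ ε) [Nonempty V] :
    1 - 4 * ε ≤ (coinMeasure V).real {ω | GoodCoins N kk thr K R R' ω} := by
  classical
  set B1 : Set (CoinTosses V) := ⋃ v : V, {ω | Heads ω v (kk (N.estimate v))} with hB1
  set B2 : Set (CoinTosses V) := {ω | ∀ v, ¬ Heads ω v (thr (N.estimate v))} with hB2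
  set B3 : Set (CoinTosses V) :=
    {ω | R' ≤ (Finset.univ.filter fun v => Heads ω v (thr (N.estimate v))).card} with hB3
  set B4 : Set (CoinTosses V) := ⋃ p ∈ (Finset.univ : Finset V) ×ˢ Finset.range (K + 1),
    {ω | R ≤ (Finset.univ.filter fun z =>
        Heads ω z (kk (N.estimate z) + N.graph.dist z p.1 - (p.2 + 2))).card ∧
      ∀ z, ¬ Heads ω z (kk (N.estimate z) + N.graph.dist z p.1 - (p.2 + 2) + 3)} with hB4
  have hn : (0 : ℝ) < Fintype.card V := Nat.cast_pos.2 Fintype.card_pos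
  have m1 : (coinMeasure V).real B1 ≤ ε := by
    calc _ ≤ ∑ v : V, (coinMeasure V).real {ω | Heads ω v (kk (N.estimate v))} :=
          measureReal_iUnion_fintype_le _
      _ ≤ ∑ _v : V, ε / (Fintype.card V) :=
          Finset.sum_le_sum fun v _ => (measure_heads_le v _).trans (h1 v)
      _ = ε := by
          rw [Finset.sum_const, Finset.card_univ, nsmul_eq_mul]
          field_simp
  have m2 : (coinMeasure V).real B2 ≤ ε := (measure_no_heads_le _).trans h2
  have m3 : (coinMeasure V).real B3 ≤ ε := (measure_many_heads_le _ R').trans h3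
  have m4 : (coinMeasure V).real B4 ≤ ε := by
    refine (measureReal_biUnion_finset_le _ _).trans ?_
    refine (Finset.sum_le_sum fun p _ => measure_gap_le _ R).trans (le_trans (le_of_eq ?_) h4)
    rw [Finset.sum_const, Finset.card_product, Finset.card_univ, Finset.card_range, nsmul_eq_mul]
    push_cast
    ring
  have hU : (Set.univ : Set (CoinTosses V)) ⊆
      {ω | GoodCoins N kk thr K R R' ω} ∪ B1 ∪ B2 ∪ B3 ∪ B4 := by
    intro ω _
    by_contra hω
    simp only [Set.mem_union, not_or] at hω
    obtain ⟨⟨⟨⟨hg, h1⟩, h2⟩, h3⟩, h4⟩ := hω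
    refine hg ⟨fun v hv => h1 (Set.mem_iUnion.2 ⟨v, hv⟩), ?_, h3, fun x τ hτ hx => h4 ?_⟩
    · by_contra! hc
      exact h2 hc
    · exact Set.mem_biUnion (x := (x, τ))
        (Finset.mem_coe.2 (Finset.mem_product.2 ⟨Finset.mem_univ x, hτ⟩)) hx
  have h0 := measureReal_mono (μ := coinMeasure V) hU
  rw [probReal_univ] at h0
  have u1 := measureReal_union_le (μ := coinMeasure V)
    ({ω | GoodCoins N kk thr K R R' ω} ∪ B1 ∪ B2 ∪ B3) B4
  have u2 := measureReal_union_le (μ := coinMeasure V)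
    ({ω | GoodCoins N kk thr K R R' ω} ∪ B1 ∪ B2) B3
  have u3 := measureReal_union_le (μ := coinMeasure V)
    ({ω | GoodCoins N kk thr K R R' ω} ∪ B1) B2
  have u4 := measureReal_union_le (μ := coinMeasure V) {ω | GoodCoins N kk thr K R R' ω} B1
  linarith

end Good

/-! ### The choice of the parameters -/

/-- the number of coins -/
def coinNumber (c A N : ℕ) : ℕ := (c + 3) * Nat.clog 2 (A * N)

/-- the wake-up round -/
def wakeRound (c A N : ℕ) : ℕ := ((c + 3) * Nat.clog 2 (A ^ 3 * N) + 2) ^ 2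

/-- the number of heads of a candidate -/
def candidateHeads (c A N : ℕ) : ℕ := Nat.log 2 (N / (A * (c + 2) * Nat.clog 2 (A * N)))

theorem Nat.clog_two_mul_le (a b : ℕ) : Nat.clog 2 (a * b) ≤ Nat.clog 2 a + Nat.clog 2 b := by
  refine Nat.clog_le_of_le_pow ?_
  rw [pow_add]
  exact Nat.mul_le_mul (Nat.le_pow_clog one_lt_two a) (Nat.le_pow_clog one_lt_two b)

theorem Nat.clog_two_pow_mul_le (a b i : ℕ) :
    Nat.clog 2 (a ^ i * b) ≤ i * Nat.clog 2 a + Nat.clog 2 b := by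
  induction i with
  | zero => simp
  | succ i ih =>
    rw [pow_succ', mul_assoc]
    refine (Nat.clog_two_mul_le _ _).trans ?_
    rw [Nat.succ_mul]
    omega

section Parameters

variable {c A n N : ℕ}

theorem coinNumber_le (h2 : N ≤ A * n) :
    coinNumber c A N ≤ (c + 3) * Nat.clog 2 (A ^ 2 * n) := by
  refine Nat.mul_le_mul_left _ (Nat.clog_mono_right 2 ?_)
  calc A * N ≤ A * (A * n) := Nat.mul_le_mul_left _ h2
    _ = A ^ 2 * n := by ring

theorem candidateHeads_le (hA : 1 ≤ A) : candidateHeads c A N ≤ coinNumber c A N := by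
  unfold candidateHeads coinNumber
  calc _ ≤ Nat.log 2 N := Nat.log_mono_right (Nat.div_le_self _ _)
    _ ≤ Nat.clog 2 N := Nat.log_le_clog 2 N
    _ ≤ Nat.clog 2 (A * N) := Nat.clog_mono_right 2 (Nat.le_mul_of_pos_left N hA)
    _ ≤ _ := Nat.le_mul_of_pos_left _ (by omega)

theorem pow_le_two_pow_coinNumber (h1 : n ≤ A * N) : n ^ (c + 3) ≤ 2 ^ coinNumber c A N := by
  unfold coinNumber
  rw [mul_comm, pow_mul]
  exact Nat.pow_le_pow_left (h1.trans (Nat.le_pow_clog one_lt_two _)) _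

/-- The third power of `A` accounts for differing estimates: `A * N_v ≤ A^2 * n ≤ A^3 * N_w`, so
every node wakes up after the last phase of every other. -/
theorem le_wakeRound (h1 : n ≤ A * N) :
    ((c + 3) * Nat.clog 2 (A ^ 2 * n) + 2) ^ 2 ≤ wakeRound c A N := by
  refine Nat.pow_le_pow_left (Nat.add_le_add_right (Nat.mul_le_mul_left _
    (Nat.clog_mono_right 2 ?_)) 2) 2
  calc A ^ 2 * n ≤ A ^ 2 * (A * N) := Nat.mul_le_mul_left _ h1
    _ = A ^ 3 * N := by ring

theorem clog_le (hn : 2 ≤ n) (i : ℕ) :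
    Nat.clog 2 (A ^ i * n) ≤ (i * Nat.clog 2 A + 1) * Nat.clog 2 n := by
  refine (Nat.clog_two_pow_mul_le _ _ _).trans ?_
  have : 1 ≤ Nat.clog 2 n := Nat.clog_pos one_lt_two hn
  nlinarith [Nat.zero_le (i * Nat.clog 2 A)]

theorem wakeRound_le (hn : 2 ≤ n) (h2 : N ≤ A * n) :
    wakeRound c A N ≤ ((c + 3) * ((4 * Nat.clog 2 A + 1) * Nat.clog 2 n) + 2) ^ 2 := by
  refine Nat.pow_le_pow_left (Nat.add_le_add_right (Nat.mul_le_mul_left _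
    (le_trans (Nat.clog_mono_right 2 ?_) (clog_le hn 4))) 2) 2
  calc A ^ 3 * N ≤ A ^ 3 * (A * n) := Nat.mul_le_mul_left _ h2
    _ = A ^ 4 * n := by ring

theorem clog_pos_of (hn : 2 ≤ n) (h1 : n ≤ A * N) : 1 ≤ Nat.clog 2 (A * N) :=
  Nat.clog_pos one_lt_two (hn.trans h1)

theorem log_le_clog (hn : 2 ≤ n) : Real.log n ≤ Nat.clog 2 n := by
  have h : (n : ℝ) ≤ 2 ^ Nat.clog 2 n := by exact_mod_cast Nat.le_pow_clog one_lt_two n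
  have hn' : (0 : ℝ) < n := by positivity
  calc Real.log n ≤ Real.log (2 ^ Nat.clog 2 n) := Real.log_le_log hn' h
    _ = Nat.clog 2 n * Real.log 2 := Real.log_pow _ _
    _ ≤ Nat.clog 2 n * 1 := by
        refine mul_le_mul_of_nonneg_left ?_ (Nat.cast_nonneg _)
        have := Real.log_two_lt_d9
        linarith
    _ = _ := mul_one _

theorem clog_le_log (hn : 2 ≤ n) : (Nat.clog 2 n : ℝ) ≤ 3 * Real.log n := by
  have h : 2 ^ (Nat.clog 2 n - 1) < n := Nat.pow_pred_clog_lt_self one_lt_two (by omega)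
  have h1 : 1 ≤ Nat.clog 2 n := Nat.clog_pos one_lt_two hn
  have h' : (2 : ℝ) ^ (Nat.clog 2 n - 1) ≤ n := by exact_mod_cast h.le
  have h2 := Real.log_le_log (by positivity) h'
  rw [Real.log_pow, Nat.cast_sub h1] at h2
  have h3 : Real.log 2 ≤ Real.log n := Real.log_le_log two_pos (by exact_mod_cast hn)
  have h4 := Real.log_two_gt_d9
  have h5 : (1 : ℝ) ≤ Nat.clog 2 n := by exact_mod_cast h1
  push_cast at h2
  nlinarith

/-- Candidates are not too rare. -/
theorem one_sub_le_exp (hA : 1 ≤ A) (hn : 2 ≤ n) (h1 : n ≤ A * N) (h2 : N ≤ A * n) :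
    1 - 1 / 2 ^ candidateHeads c A N ≤ Real.exp (-((c + 2) * Real.log n / n)) := by
  set lam := Nat.clog 2 (A * N) with hlam
  have hlam1 : 1 ≤ lam := clog_pos_of hn h1
  have hmono : Nat.clog 2 n ≤ lam := Nat.clog_mono_right 2 h1
  -- If the quotient is zero, then `Nat.log` takes its default value 0, and a node with this
  -- estimate is certainly a candidate.
  rcases Nat.eq_zero_or_pos (N / (A * (c + 2) * lam)) with h0 | h0
  · have : candidateHeads c A N = 0 := by rw [candidateHeads, h0, Nat.log_zero_right]
    rw [this]
    simpa using (Real.exp_pos _).le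
  · have h3 : 2 ^ candidateHeads c A N * (A * (c + 2) * lam) ≤ N :=
      (Nat.mul_le_mul_right _ (Nat.pow_log_le_self 2 h0.ne')).trans (Nat.div_mul_le_self _ _)
    have h4 : 2 ^ candidateHeads c A N * ((c + 2) * lam) ≤ n := by
      refine Nat.le_of_mul_le_mul_left ?_ hA
      calc A * (2 ^ candidateHeads c A N * ((c + 2) * lam))
          = 2 ^ candidateHeads c A N * (A * (c + 2) * lam) := by ring
        _ ≤ A * n := h3.trans h2
    have h5 : (2 : ℝ) ^ candidateHeads c A N * ((c + 2) * lam) ≤ n := by exact_mod_cast h4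
    have h6 : (c + 2) * Real.log n / n ≤ 1 / 2 ^ candidateHeads c A N := by
      have hl : Real.log n ≤ lam := (log_le_clog hn).trans (by exact_mod_cast hmono)
      have hn' : (0 : ℝ) < n := by positivity
      rw [div_le_div_iff₀ hn' (by positivity), one_mul, mul_comm]
      refine le_trans (mul_le_mul_of_nonneg_left ?_ (by positivity)) h5
      exact mul_le_mul_of_nonneg_left hl (by positivity)
    have := Real.add_one_le_exp (-((c + 2) * Real.log n / n))
    linarith

/-- Candidates are not too frequent. -/
theorem candidate_prob_le (hA : 1 ≤ A) (hn : 2 ≤ n) (h1 : n ≤ A * N) (h2 : N ≤ A * n) :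
    (1 / 2 ^ candidateHeads c A N : ℝ) ≤
      2 * A ^ 2 * (c + 2) * ((4 * Nat.clog 2 A + 1) * Nat.clog 2 n) / n := by
  set lam := Nat.clog 2 (A * N) with hlam
  have hlam1 : 1 ≤ lam := clog_pos_of hn h1
  have hle : lam ≤ (4 * Nat.clog 2 A + 1) * Nat.clog 2 n := by
    refine le_trans (Nat.clog_mono_right 2 ?_) (clog_le hn 4)
    calc A * N ≤ A * (A * n) := Nat.mul_le_mul_left _ h2
      _ = A ^ 2 * n := by ring
      _ ≤ A ^ 4 * n := Nat.mul_le_mul_right _ (Nat.pow_le_pow_right hA (by norm_num))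
  have h3 : N / (A * (c + 2) * lam) < 2 ^ (candidateHeads c A N + 1) :=
    Nat.lt_pow_succ_log_self one_lt_two _
  have h4 : N < 2 ^ (candidateHeads c A N + 1) * (A * (c + 2) * lam) :=
    (Nat.div_lt_iff_lt_mul (by positivity)).1 h3
  have h5 : n ≤ 2 ^ candidateHeads c A N *
      (2 * A ^ 2 * (c + 2) * ((4 * Nat.clog 2 A + 1) * Nat.clog 2 n)) := by
    calc n ≤ A * N := h1
      _ ≤ A * (2 ^ (candidateHeads c A N + 1) * (A * (c + 2) * lam)) :=
          Nat.mul_le_mul_left _ h4.le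
      _ = 2 ^ candidateHeads c A N * (2 * A ^ 2 * (c + 2) * lam) := by ring
      _ ≤ _ := Nat.mul_le_mul_left _ (Nat.mul_le_mul_left _ hle)
  have hn' : (0 : ℝ) < n := by positivity
  rw [div_le_div_iff₀ (by positivity) hn', one_mul, mul_comm]
  exact_mod_cast h5

end Parameters

/-! ### Binary versus natural logarithms -/

section Asymptotics

variable {n : ℕ}

theorem half_le_log (hn : 2 ≤ n) : 1 / 2 ≤ Real.log n := by
  have h : Real.log 2 ≤ Real.log n := Real.log_le_log two_pos (by exact_mod_cast hn)
  have := Real.log_two_gt_d9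
  linarith

theorem clog_sq_le (hn : 2 ≤ n) : (Nat.clog 2 n : ℝ) ^ 2 ≤ 18 * Real.log n ^ 3 := by
  have h1 := clog_le_log hn
  have h2 := half_le_log hn
  have h3 := pow_le_pow_left₀ (Nat.cast_nonneg _) h1 2
  have h4 : 0 ≤ Real.log n ^ 2 * (Real.log n - 1 / 2) := mul_nonneg (sq_nonneg _) (by linarith)
  nlinarith

theorem clog_cube_le (hn : 2 ≤ n) : (Nat.clog 2 n : ℝ) ^ 3 ≤ 54 * Real.log n ^ 4 := by
  have h1 := clog_le_log hn
  have h2 := half_le_log hn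
  have h3 := pow_le_pow_left₀ (Nat.cast_nonneg _) h1 3
  have h4 : 0 ≤ Real.log n ^ 3 * (Real.log n - 1 / 2) :=
    mul_nonneg (pow_nonneg (by linarith) 3) (by linarith)
  nlinarith

end Asymptotics

/-- The left side is the expectation of 2 to the power of the number of candidates; use `1 + p ≤ exp
p` and `exp 1 ≤ 4`. -/
theorem many_candidates_bound {V : Type u} [Fintype V] {p : V → ℝ} {P : ℕ}
    (hp : ∀ v, p v ≤ P / Fintype.card V) (h0 : ∀ v, 0 ≤ p v) [Nonempty V] :
    ∏ v, (1 + p v) ≤ 2 ^ (2 * P) := by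
  have hn : (0 : ℝ) < Fintype.card V := Nat.cast_pos.2 Fintype.card_pos
  calc ∏ v, (1 + p v) ≤ ∏ v, Real.exp (P / Fintype.card V) := by
        refine Finset.prod_le_prod (fun v _ => by linarith [h0 v]) fun v _ => ?_
        have := Real.add_one_le_exp (p v)
        have := Real.exp_le_exp.2 (hp v)
        linarith
    _ = Real.exp P := by
        rw [Finset.prod_const, Finset.card_univ, ← Real.exp_nat_mul]
        congr 1
        field_simp
    _ = Real.exp 1 ^ P := by rw [← Real.exp_nat_mul, mul_one]
    _ ≤ 4 ^ P := by
        refine pow_le_pow_left₀ (Real.exp_pos 1).le ?_ P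
        have := Real.exp_one_lt_d9
        linarith
    _ = 2 ^ (2 * P) := by rw [pow_mul]; norm_num

theorem few_candidates_bound {V : Type u} [Fintype V] {p : V → ℝ} {c : ℕ}
    (hp : ∀ v, 1 - p v ≤ Real.exp (-((c + 2) * Real.log (Fintype.card V) / Fintype.card V)))
    (h1 : ∀ v, p v ≤ 1) [Nonempty V] :
    ∏ v, (1 - p v) ≤ 1 / (Fintype.card V : ℝ) ^ (c + 2) := by
  have hn : (0 : ℝ) < Fintype.card V := Nat.cast_pos.2 Fintype.card_pos
  calc ∏ v, (1 - p v) ≤ ∏ _v : V,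
        Real.exp (-((c + 2) * Real.log (Fintype.card V) / Fintype.card V)) :=
        Finset.prod_le_prod (fun v _ => by linarith [h1 v]) fun v _ => hp v
    _ = Real.exp (-(((c + 2 : ℕ) : ℝ) * Real.log (Fintype.card V))) := by
        rw [Finset.prod_const, Finset.card_univ, ← Real.exp_nat_mul]
        congr 1
        push_cast
        field_simp
    _ = _ := by
        rw [Real.exp_neg, Real.exp_nat_mul, Real.exp_log hn, one_div]

/-- Since `(7/8)^6 ≤ 1/2`, six factors halve the bound. The summand `K` in the exponent absorbs `K +
1 ≤ 2^K`, the number of values of `τ` in the union bound. -/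
theorem gap_bound {n c K l : ℕ} (hl : n ≤ 2 ^ l) (hn : 0 < n) :
    (n : ℝ) * (K + 1) * (7 / 8) ^ (6 * ((c + 3) * l + K)) ≤ 1 / (n : ℝ) ^ (c + 2) := by
  have hn' : (0 : ℝ) < n := Nat.cast_pos.2 hn
  have hl' : (n : ℝ) ≤ 2 ^ l := by exact_mod_cast hl
  have hK : (K : ℝ) + 1 ≤ 2 ^ K := by exact_mod_cast Nat.lt_two_pow_self (n := K)
  have h1 : (7 / 8 : ℝ) ^ (6 * ((c + 3) * l + K)) ≤ (1 / 2) ^ ((c + 3) * l + K) := by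
    rw [pow_mul]
    exact pow_le_pow_left₀ (by positivity) (by norm_num) _
  have h2 : (n : ℝ) ^ (c + 3) ≤ 2 ^ ((c + 3) * l) := by
    rw [mul_comm, pow_mul]
    exact pow_le_pow_left₀ hn'.le hl' _
  rw [le_div_iff₀ (by positivity)]
  calc (n : ℝ) * (K + 1) * (7 / 8) ^ (6 * ((c + 3) * l + K)) * n ^ (c + 2)
      = n ^ (c + 3) * (K + 1) * (7 / 8) ^ (6 * ((c + 3) * l + K)) := by ring
    _ ≤ 2 ^ ((c + 3) * l) * 2 ^ K * (1 / 2) ^ ((c + 3) * l + K) := by gcongr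
    _ = 1 := by
        rw [← pow_add, ← mul_pow]
        norm_num

/-! ### The main theorem -/

theorem mainTheorem5 (a : ℝ) (ha : 1 ≤ a) (c : ℕ) :
    ∃ (A : KT1LocalAlgorithm) (C : ℝ), ∀ (V : Type u) [Fintype V] (N : Network V),
      N.graph.Connected →
      Function.Injective N.id →
      (∀ v : V, (Fintype.card V : ℝ) ≤ a * (N.estimate v : ℝ) ∧
        (N.estimate v : ℝ) ≤ a * (Fintype.card V : ℝ)) →
      1 - 1 / (Fintype.card V : ℝ) ^ c ≤ (coinMeasure V).real
        {ω : CoinTosses V |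
          A.ElectsLeaderWithin N ω
            (C * ((N.graph.diam : ℝ) * Real.log (Fintype.card V : ℝ) +
              Real.log (Fintype.card V : ℝ) ^ 3)) ∧
          A.MessagesAtMost N ω
            (C * ((Fintype.card V : ℝ) * Real.log (Fintype.card V : ℝ) ^ 4))} := by
  obtain ⟨A, hA⟩ : ∃ A : ℕ, A = ⌈a⌉₊ := ⟨_, rfl⟩
  have haA : a ≤ A := hA ▸ Nat.le_ceil a
  have hA1 : 1 ≤ A := by exact_mod_cast ha.trans haA
  -- With `l = Nat.clog 2 n`, the numbers of coins are at most `k * l`, `r * l` is the threshold for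
  -- nearby centres as in `gap_bound`, and `r' * l` that for candidates: twice a bound for their
  -- expected number plus `(c + 2) * l` for the error probability.
  obtain ⟨m, hm⟩ : ∃ m, m = 4 * Nat.clog 2 A + 1 := ⟨_, rfl⟩
  obtain ⟨k, hk⟩ : ∃ k, k = (c + 3) * m := ⟨_, rfl⟩
  obtain ⟨r, hr⟩ : ∃ r, r = 6 * (c + 3 + k) := ⟨_, rfl⟩
  obtain ⟨r', hr'⟩ : ∃ r', r' = 4 * A ^ 2 * (c + 2) * m + (c + 2) := ⟨_, rfl⟩
  obtain ⟨C₁, hC₁⟩ : ∃ C₁, C₁ = 3 * (k + 2) ^ 2 + 8 * (2 * k + 1) + 4 := ⟨_, rfl⟩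
  obtain ⟨C₂, hC₂⟩ : ∃ C₂, C₂ = 2 * r * ((k + 2) ^ 2 + 2 * r' + 1) := ⟨_, rfl⟩
  refine ⟨electionAlgorithm (coinNumber c A) (wakeRound c A) (candidateHeads c A),
    -- The factor 54 comes from `l ≤ 3 log n` and `log n ≥ 1/2`, which give `l^2 ≤ 18 log^3 n` and
    -- `l^3 ≤ 54 log^4 n`.
    54 * (C₁ + C₂ : ℕ), fun V _ N hconn hinj hN => ?_⟩
  have : Nonempty V := hconn.nonempty
  obtain ⟨n, hn⟩ : ∃ n, n = Fintype.card V := ⟨_, rfl⟩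
  have hn0 : 0 < n := hn ▸ Fintype.card_pos
  rw [← hn] at hN ⊢
  rcases Nat.lt_or_ge n 2 with hlt | hn2
  -- Here both bounds are 0, but so is the required probability.
  · obtain rfl : n = 1 := by omega
    simp
  have hN1 : ∀ v, n ≤ A * N.estimate v := fun v => by
    have : (n : ℝ) ≤ A * N.estimate v :=
      (hN v).1.trans (mul_le_mul_of_nonneg_right haA (Nat.cast_nonneg _))
    exact_mod_cast this
  have hN2 : ∀ v, N.estimate v ≤ A * n := fun v => by
    have : (N.estimate v : ℝ) ≤ A * n :=
      (hN v).2.trans (mul_le_mul_of_nonneg_right haA (Nat.cast_nonneg _))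
    exact_mod_cast this
  obtain ⟨l, hl⟩ : ∃ l, l = Nat.clog 2 n := ⟨_, rfl⟩
  have hl1 : 1 ≤ l := hl ▸ Nat.clog_pos one_lt_two hn2
  have hnl : n ≤ 2 ^ l := hl ▸ Nat.le_pow_clog one_lt_two n
  have hn' : (0 : ℝ) < n := Nat.cast_pos.2 hn0
  have hkk : ∀ v, coinNumber c A (N.estimate v) ≤ (c + 3) * Nat.clog 2 (A ^ 2 * n) :=
    fun v => coinNumber_le (hN2 v)
  -- Each of the four kinds of bad event gets probability `1 / n^(c + 2)`; since `4 ≤ n^2`, they sum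
  -- to at most `1 / n^c`.
  have hprob := one_sub_le_measure_good (N := N) (kk := coinNumber c A) (thr := candidateHeads c A)
    (K := k * l) (R := r * l) (R' := r' * l) (ε := 1 / (n : ℝ) ^ (c + 2)) ?_ ?_ ?_ ?_
  · refine le_trans ?_ (hprob.trans (measureReal_mono fun ω hω => ?_))
    · have h4 : (4 : ℝ) ≤ n ^ 2 := by
        have : (2 : ℝ) ≤ n := by exact_mod_cast hn2
        nlinarith
      have : 4 * (1 / (n : ℝ) ^ (c + 2)) ≤ 1 / n ^ c := by
        rw [mul_one_div, div_le_div_iff₀ (by positivity) (by positivity), pow_add, one_mul,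
          mul_comm]
        exact mul_le_mul_of_nonneg_left h4 (by positivity)
      linarith
    · have hlog := half_le_log hn2
      refine GoodCoins.succeeds hω hconn hinj (fun v => le_wakeRound (hN1 v))
        (hi := (k * l + 2) ^ 2) (fun v => ?_) (fun v => ?_) (fun v => ?_)
        (fun v => candidateHeads_le hA1) ?_ ?_
      · refine (wakeRound_le hn2 (hN2 v)).trans (le_of_eq ?_)
        rw [hk, hm, hl, mul_assoc]
      · exact Nat.pow_lt_pow_left (Nat.add_lt_add_of_le_of_lt (hkk v) one_lt_two) two_ne_zero
      · refine (hkk v).trans ?_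
        rw [hk, mul_assoc]
        refine Nat.mul_le_mul_left _ ((clog_le hn2 2).trans ?_)
        rw [hm, hl]
        exact Nat.mul_le_mul_right _ (by omega)
      · have h1 : 3 * (k * l + 2) ^ 2 + 8 * ((2 * (k * l) + 1) * N.graph.diam) + 4 ≤
            C₁ * (N.graph.diam * l + l ^ 2) := by
          have e1 : k * l + 2 ≤ (k + 2) * l := by nlinarith
          have e2 : 2 * (k * l) + 1 ≤ (2 * k + 1) * l := by nlinarith
          have e3 : 1 ≤ l ^ 2 := Nat.one_le_pow _ _ hl1
          calc _ ≤ 3 * ((k + 2) * l) ^ 2 + 8 * ((2 * k + 1) * l * N.graph.diam) + 4 * l ^ 2 := by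
                gcongr
                omega
            _ ≤ _ := by
                rw [hC₁]
                nlinarith [Nat.zero_le ((3 * (k + 2) ^ 2 + 4) * (N.graph.diam * l)),
                  Nat.zero_le (8 * (2 * k + 1) * l ^ 2)]
        have h1' : ((3 * (k * l + 2) ^ 2 + 8 * ((2 * (k * l) + 1) * N.graph.diam) + 4 : ℕ) : ℝ) ≤
            C₁ * (N.graph.diam * l + l ^ 2) := by exact_mod_cast h1
        refine h1'.trans ?_
        have h2 : (l : ℝ) ≤ 3 * Real.log n := hl ▸ clog_le_log hn2
        have h3 : (l : ℝ) ^ 2 ≤ 18 * Real.log n ^ 3 := hl ▸ clog_sq_le hn2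
        have h4 : (N.graph.diam : ℝ) * l + l ^ 2 ≤
            54 * (N.graph.diam * Real.log n + Real.log n ^ 3) := by
          have e1 : (N.graph.diam : ℝ) * l ≤ N.graph.diam * (3 * Real.log n) :=
            mul_le_mul_of_nonneg_left h2 (Nat.cast_nonneg _)
          have e2 : 0 ≤ (N.graph.diam : ℝ) * Real.log n := by positivity
          have e3 : 0 ≤ Real.log n ^ 3 := by positivity
          linarith
        calc (C₁ : ℝ) * (N.graph.diam * l + l ^ 2)
            ≤ (C₁ + C₂ : ℕ) * (54 * (N.graph.diam * Real.log n + Real.log n ^ 3)) := by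
              gcongr
              omega
          _ = _ := by ring
      · have h1 : 2 * (n * (r * l)) * ((k * l + 2) ^ 2 + 2 * (r' * l) + 1) ≤
            C₂ * (n * l ^ 3) := by
          have e1 : k * l + 2 ≤ (k + 2) * l := by nlinarith
          have e2 : l ≤ l ^ 2 := Nat.le_self_pow two_ne_zero l
          have e3 : 1 ≤ l ^ 2 := Nat.one_le_pow _ _ hl1
          calc _ ≤ 2 * (n * (r * l)) * (((k + 2) * l) ^ 2 + 2 * (r' * l ^ 2) + l ^ 2) := by
                gcongr
            _ = _ := by rw [hC₂]; ring
        rw [← hn]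
        have h1' : ((2 * (n * (r * l)) * ((k * l + 2) ^ 2 + 2 * (r' * l) + 1) : ℕ) : ℝ) ≤
            C₂ * (n * l ^ 3) := by exact_mod_cast h1
        refine h1'.trans ?_
        have h3 : (l : ℝ) ^ 3 ≤ 54 * Real.log n ^ 4 := hl ▸ clog_cube_le hn2
        calc (C₂ : ℝ) * (n * l ^ 3) ≤ (C₁ + C₂ : ℕ) * (n * (54 * Real.log n ^ 4)) := by
              gcongr
              omega
          _ = _ := by ring
  · intro v
    rw [← hn, div_div, ← pow_succ]
    refine one_div_le_one_div_of_le (by positivity) ?_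
    exact_mod_cast pow_le_two_pow_coinNumber (c := c) (hN1 v)
  · rw [hn]
    refine few_candidates_bound (p := fun v => 1 / 2 ^ candidateHeads c A (N.estimate v))
      (fun v => ?_) (fun v => ?_)
    · rw [← hn]
      exact one_sub_le_exp hA1 hn2 (hN1 v) (hN2 v)
    · rw [div_le_one (by positivity)]
      exact one_le_pow₀ one_le_two
  · have h1 := many_candidates_bound (V := V)
      (p := fun v => 1 / 2 ^ candidateHeads c A (N.estimate v))
      (P := 2 * A ^ 2 * (c + 2) * (m * l)) (fun v => ?_) (fun v => by positivity)
    · rw [div_le_iff₀ (by positivity)]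
      refine h1.trans ?_
      have e : r' * l = 2 * (2 * A ^ 2 * (c + 2) * (m * l)) + l * (c + 2) := by rw [hr']; ring
      have h2 : (n : ℝ) ^ (c + 2) ≤ (2 ^ l) ^ (c + 2) :=
        pow_le_pow_left₀ hn'.le (by exact_mod_cast hnl) _
      rw [e, pow_add (2 : ℝ) _ (l * (c + 2)), pow_mul 2 l, one_div_mul_eq_div, le_div_iff₀ (by positivity)]
      exact mul_le_mul_of_nonneg_left h2 (by positivity)
    · rw [← hn]
      have := candidate_prob_le (c := c) hA1 hn2 (hN1 v) (hN2 v)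
      rw [← hl] at this
      push_cast
      rw [hm]
      push_cast
      exact this
  · rw [← hn]
    have e : r * l = 6 * ((c + 3) * l + k * l) := by rw [hr]; ring
    rw [e]
    exact gap_bound hnl hn0
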